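/- Let $n\ge 1$ be an integer, let $B_n$ be the group, under composition, of all bijections $w$ of the set $\{\pm1,\dots,\pm n\}$ onto itself with $w(-i)=-w(i)$ for $1\le i\le n$, and let $D_n$ (the classical Weyl group of type $D_n$) be the subgroup of $B_n$ consisting of all $w$ for which the number of $i\in\{1,\dots,n\}$ with $w(i)<0$ is even. Then for every integer $k$ (positive, negative or zero), the $k$-th root enumerator of $D_n$, $$g\;\longmapsto\;\#\{h\in D_n : h^k=g\}\qquad (g\in D_n),$$ is a proper character of $D_n$, i.e. a linear combination, with nonnegative integer coefficients, of characters of irreducible finite-dimensional complex representations of $D_n$. -/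

import Mathlib

/-- The group `B_n` of signed permutations: the bijections `w` of `{±1, …, ±n}` with
`w (-i) = - w i`, under composition. The element `ε · i` of `{±1, …, ±n}` (with `ε = ±1`) is
written as the pair `(i, ε) : Fin n × ℤˣ`, so that negation is `(i, ε) ↦ (i, -ε)`. -/
def signedPerm (n : ℕ) : Subgroup (Equiv.Perm (Fin n × ℤˣ)) where
  carrier := {w | ∀ (i : Fin n) (ε : ℤˣ), w (i, -ε) = ((w (i, ε)).1, -(w (i, ε)).2)}
  one_mem' := fun _ _ => rfl
  mul_mem' := by
    intro v w hv hw i ε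
    change v (w (i, -ε)) = ((v (w (i, ε))).1, -(v (w (i, ε))).2)
    rw [hw i ε, hv]
  inv_mem' := by
    intro w hw i ε
    rw [Equiv.Perm.inv_eq_iff_eq, hw]
    simp

/-- `w (i, ε) = (j, ε δ)` whenever `w (i, 1) = (j, δ)`. -/
theorem signedPerm_apply {n : ℕ} {w : Equiv.Perm (Fin n × ℤˣ)} (hw : w ∈ signedPerm n)
    (i : Fin n) (ε : ℤˣ) : w (i, ε) = ((w (i, 1)).1, ε * (w (i, 1)).2) := by
  rcases Int.units_eq_one_or ε with rfl | rfl
  · simp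
  · have h := hw i 1
    simpa using h

/-- The map `i ↦ |w i|` is injective. -/
theorem signedPerm_abs_injective {n : ℕ} {w : Equiv.Perm (Fin n × ℤˣ)}
    (hw : w ∈ signedPerm n) : Function.Injective fun i : Fin n => (w (i, 1)).1 := by
  intro i j hij
  have hij' : (w (i, 1)).1 = (w (j, 1)).1 := hij
  have h : w (i, (w (i, 1)).2) = w (j, (w (j, 1)).2) := by
    rw [signedPerm_apply hw i, signedPerm_apply hw j, Int.units_mul_self, Int.units_mul_self,
      hij']
  exact congrArg Prod.fst (w.injective h)

/-- The linear character `χ` of `B_n`: the product of the signs of `w 1, …, w n`. -/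
def signChar (n : ℕ) : signedPerm n →* ℤˣ where
  toFun w := ∏ i : Fin n, (w.1 (i, 1)).2
  map_one' := by simp
  map_mul' := by
    intro v w
    have key : ∀ i : Fin n, ((v * w).1 (i, 1)).2
        = (v.1 ((w.1 (i, 1)).1, 1)).2 * (w.1 (i, 1)).2 := by
      intro i
      change (v.1 (w.1 (i, 1))).2 = _
      have h := signedPerm_apply v.2 (w.1 (i, 1)).1 (w.1 (i, 1)).2
      rw [Prod.mk.eta] at h
      rw [h, mul_comm]
    rw [Finset.prod_congr rfl fun i _ => key i, Finset.prod_mul_distrib]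
    congr 1
    exact Function.Bijective.prod_comp
      (Finite.injective_iff_bijective.mp (signedPerm_abs_injective w.2))
      (fun j => (v.1 (j, 1)).2)

/-- The classical Weyl group of type `D_n`: the signed permutations `w` for which the product of
the signs of `w 1, …, w n` is `1`, i.e. an even number of them are negative (see
`mem_weylD_iff`). -/
def weylD (n : ℕ) : Subgroup (signedPerm n) := (signChar n).ker

theorem mem_weylD_iff {n : ℕ} (w : signedPerm n) :
    w ∈ weylD n ↔ Even (Finset.univ.filter fun i : Fin n => (w.1 (i, 1)).2 = -1).card := by
  have h : signChar n w =
      (-1 : ℤˣ) ^ (Finset.univ.filter fun i : Fin n => (w.1 (i, 1)).2 = -1).card := by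
    rw [← Finset.prod_const (-1 : ℤˣ), Finset.prod_filter]
    change (∏ i : Fin n, (w.1 (i, 1)).2) = _
    refine Finset.prod_congr rfl fun i _ => ?_
    rcases Int.units_eq_one_or (w.1 (i, 1)).2 with h | h <;> simp [h]
  rw [weylD, MonoidHom.mem_ker, h]
  exact neg_one_pow_eq_one_iff_even (R := ℤˣ) (by decide)

/-- The `k`-th root enumerator of a finite group `G`: the number of `h ∈ G` with `h ^ k = g`. -/
noncomputable def rootEnumerator (G : Type*) [Group G] [Finite G] (k : ℤ) (g : G) : ℕ :=
  Nat.card {h : G // h ^ k = g}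

/-- `χ` is the character of an irreducible finite-dimensional complex representation of `G`. -/
def IsIrreducibleCharacter {G : Type*} [Group G] (χ : G → ℂ) : Prop :=
  ∃ (V : Type) (_ : AddCommGroup V) (_ : Module ℂ V) (_ : FiniteDimensional ℂ V)
    (ρ : Representation ℂ G V), ρ.IsIrreducible ∧ χ = ρ.character

/-- `f` is a proper character of the finite group `G`: a linear combination of irreducible
characters with nonnegative integer coefficients, i.e. a finite sum of irreducible characters
(with repetitions allowed). -/
def IsProperCharacter {G : Type*} [Group G] [Finite G] (f : G → ℂ) : Prop :=
  f ∈ AddSubmonoid.closure {χ : G → ℂ | IsIrreducibleCharacter χ}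

/-! The pairing of the `k`-th root enumerator with an irreducible character `χ` is the
Frobenius–Schur indicator `|G|⁻¹ ∑ χ(g ^ k)`, which is an algebraic integer for every finite group
(`isIntegral_frobeniusSchur`). It therefore suffices to show that for `D_n` this number is a
nonnegative rational. That follows once the enumerator is half of a sum of linear characters of
subgroups, each extended by zero: such a term pairs with `χ` to `|H| / |G|` times a multiplicity
(`isProperCharacter_rootEnumerator_of_monomial`).

To find such an expression, write a signed permutation as a permutation `η` with a sign vector. For
fixed `η`, Fourier inversion over sign vectors (`sum_signs_eq`) turns the count of admissible
vectors into half of a sum over `c ∈ {0, 1}` and subsets `T`, restricted by a parity condition; `c`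
is dual to the condition defining `D_n`.

For fixed `(c, T)` the roots `η` of `σ = |g|` satisfying that parity condition remain to be counted.
In the symmetric group, the number of `k`-th roots of `σ` is the sum, over the `η` commuting with
`σ` with `η ^ k = 1`, of the value at `σ` of a linear character of the centralizer of `η`
(`sum_cycleCharacter_eq_card`). The proof averages over independent rotations of one `σ`-cycle in
each orbit of `⟨σ, η⟩`; both sides then factor over these orbits, and the local identity
`sum_dualRoot` is the vanishing of sums of roots of unity. Rotations do not change the action of `η`
on the set of `σ`-cycles, and when `σ` preserves `T` the parity condition depends on nothing else,
so it survives the averaging. -/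

/-! ### Orthogonality and completeness of irreducible characters -/

/-- The bilinear pairing `|G|⁻¹ ∑ φ(g) ψ(g⁻¹)` of functions on a finite group. -/
noncomputable def classPairing {G : Type*} [Group G] [Fintype G] (φ ψ : G → ℂ) : ℂ :=
  (Nat.card G : ℂ)⁻¹ * ∑ g : G, φ g * ψ g⁻¹

theorem classPairing_sum_smul {G ι : Type*} [Group G] [Fintype G] (s : Finset ι) (c : ι → ℂ)
    (φ : ι → G → ℂ) (ψ : G → ℂ) :
    classPairing (∑ i ∈ s, c i • φ i) ψ = ∑ i ∈ s, c i * classPairing (φ i) ψ := by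
  simp only [classPairing, Finset.sum_apply, Pi.smul_apply, smul_eq_mul, Finset.sum_mul,
    Finset.mul_sum]
  rw [Finset.sum_comm]
  refine Finset.sum_congr rfl fun i _ => Finset.sum_congr rfl fun g _ => ?_
  ring

theorem classPairing_sub {G : Type*} [Group G] [Fintype G] (φ φ' ψ : G → ℂ) :
    classPairing (φ - φ') ψ = classPairing φ ψ - classPairing φ' ψ := by
  simp only [classPairing, Pi.sub_apply, sub_mul, Finset.sum_sub_distrib, mul_sub]

theorem natCard_complex_ne_zero (G : Type*) [Group G] [Finite G] : (Nat.card G : ℂ) ≠ 0 := by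
  exact_mod_cast Nat.card_pos.ne'

open scoped Classical in
theorem classPairing_irreducible {G : Type*} [Group G] [Fintype G] {χ ψ : G → ℂ}
    (hχ : IsIrreducibleCharacter χ) (hψ : IsIrreducibleCharacter ψ) :
    classPairing χ ψ = if χ = ψ then 1 else 0 := by
  have := invertibleOfNonzero (natCard_complex_ne_zero G)
  obtain ⟨V, _, _, _, ρ, hρ, rfl⟩ := hχ
  obtain ⟨W, _, _, _, σ, hσ, rfl⟩ := hψ
  split_ifs with h
  · rw [← h, classPairing, Representation.char_orthonormal ρ ρ, if_pos ⟨.refl ρ⟩]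
  · rw [classPairing, Representation.char_orthonormal ρ σ, if_neg]
    rintro ⟨e⟩
    exact h (Representation.char_iso e).symm

/-- Orthonormality makes irreducible characters linearly independent in the finite-dimensional space
of functions on `G`. -/
theorem finite_irreducibleCharacter (G : Type*) [Group G] [Fintype G] :
    {χ : G → ℂ | IsIrreducibleCharacter χ}.Finite := by
  classical
  have h : LinearIndependent ℂ
      (Subtype.val : {χ : G → ℂ | IsIrreducibleCharacter χ} → G → ℂ) := by
    rw [linearIndependent_iff']
    intro s c hc i hi
    have := congrArg (fun φ => classPairing φ i.1) hc
    simp only [classPairing_sum_smul] at this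
    rw [Finset.sum_congr rfl fun j _ => by
      rw [classPairing_irreducible j.2 i.2, mul_ite, mul_one, mul_zero]] at this
    simp only [Subtype.val_inj, Finset.sum_ite_eq', hi, if_true] at this
    rw [this]
    simp [classPairing]
  exact h.setFinite

/-- A class function orthogonal to the character of an irreducible representation acts as zero
on it. -/
theorem sum_smul_eq_zero_of_irreducible {G V : Type*} [Group G] [Fintype G] [AddCommGroup V]
    [Module ℂ V] [FiniteDimensional ℂ V] (ρ : Representation ℂ G V) [ρ.IsIrreducible]
    (f : G → ℂ) (hf : ∀ x g, f (x * g * x⁻¹) = f g)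
    (h0 : classPairing f ρ.character = 0) : ∑ g, f g • ρ g⁻¹ = 0 := by
  set T : V →ₗ[ℂ] V := ∑ g, f g • ρ g⁻¹ with hT
  have hcomm : ∀ x, T ∘ₗ ρ x = ρ x ∘ₗ T := by
    intro x
    have h1 : T ∘ₗ ρ x = ∑ g, f g • (ρ (g⁻¹ * x)) := by
      rw [hT]
      ext v
      simp [LinearMap.sum_apply]
    have h2 : ρ x ∘ₗ T = ∑ g, f g • (ρ (x * g⁻¹)) := by
      rw [hT]
      ext v
      simp [LinearMap.sum_apply]
    rw [h1, h2]
    refine Fintype.sum_equiv (MulAut.conj x⁻¹).toEquiv _ _ fun g => ?_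
    have h3 : (MulAut.conj x⁻¹).toEquiv g = x⁻¹ * g * x⁻¹⁻¹ := rfl
    rw [h3, hf, mul_inv_rev, mul_inv_rev, inv_inv, inv_inv]
    congr 2
    group
  -- By Schur's lemma `T` is a scalar `c`. Its trace `c * dim V` is `|G|` times the pairing, hence
  -- zero.
  obtain ⟨c, hc⟩ :=
    (Representation.IsIrreducible.algebraMap_intertwiningMap_bijective_of_isAlgClosed
      (ρ := ρ)).2 ⟨T, hcomm⟩
  have hTc : T = c • (1 : V →ₗ[ℂ] V) := by
    have := congrArg Representation.IntertwiningMap.toLinearMap hc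
    rw [show T = _ from this.symm]
    ext v
    rfl
  have htr : LinearMap.trace ℂ V T = 0 := by
    rw [hT, map_sum]
    simp only [map_smul, smul_eq_mul]
    rw [classPairing] at h0
    rcases mul_eq_zero.1 h0 with h | h
    · exact absurd h (inv_ne_zero (natCard_complex_ne_zero G))
    · exact h
  rw [hTc, map_smul, LinearMap.trace_one, smul_eq_mul] at htr
  rcases mul_eq_zero.1 htr with h | h
  · rw [hTc, h, zero_smul]
  · have : Subsingleton V := Module.finrank_zero_iff.1 (by exact_mod_cast h)
    exact Subsingleton.elim _ _

/-- A simple `ℂ[G]`-module, as an irreducible representation. -/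
theorem exists_irreducible_of_isSimpleModule {G : Type} [Group G] [Finite G]
    (S : Type) [AddCommGroup S] [Module (MonoidAlgebra ℂ G) S]
    [IsSimpleModule (MonoidAlgebra ℂ G) S] :
    ∃ (V : Type) (_ : AddCommGroup V) (_ : Module ℂ V) (ρ : Representation ℂ G V) (e : V ≃+ S),
      FiniteDimensional ℂ V ∧ ρ.IsIrreducible ∧
        ∀ z v, e (ρ.asAlgebraHom z v) = z • e v := by
  refine ⟨RestrictScalars ℂ (MonoidAlgebra ℂ G) S,
    instAddCommGroupRestrictScalars ℂ (MonoidAlgebra ℂ G) S,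
    RestrictScalars.module ℂ (MonoidAlgebra ℂ G) S,
    Representation.ofModule (k := ℂ) (G := G) S, AddEquiv.refl S, ?_,
    (Representation.isSimpleModule_iff_irreducible_ofModule (k := ℂ) (G := G) S).1 ‹_›,
    fun z v => Representation.ofModule_asAlgebraHom_apply_apply (k := ℂ) (G := G) S z v⟩
  let _ : Module ℂ S := RestrictScalars.module ℂ (MonoidAlgebra ℂ G) S
  have : IsScalarTower ℂ (MonoidAlgebra ℂ G) S :=
    ⟨fun c z v => mul_smul (algebraMap ℂ (MonoidAlgebra ℂ G) c) z v ▸ by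
      rw [Algebra.smul_def]⟩
  have : Module.Finite ℂ S := Module.Finite.trans (MonoidAlgebra ℂ G) S
  exact this

theorem sum_smul_single_eq_zero_of_simple {G : Type} [Group G] [Fintype G] (f : G → ℂ)
    (hf : ∀ x g, f (x * g * x⁻¹) = f g)
    (h0 : ∀ χ, IsIrreducibleCharacter χ → classPairing f χ = 0)
    (S : Type) [AddCommGroup S] [Module (MonoidAlgebra ℂ G) S]
    [hS : IsSimpleModule (MonoidAlgebra ℂ G) S] (x : S) :
    (∑ g, f g • (MonoidAlgebra.single g⁻¹ 1 : MonoidAlgebra ℂ G)) • x = 0 := by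
  obtain ⟨V, _, _, ρ, e, _, hirr, he⟩ := exists_irreducible_of_isSimpleModule (G := G) S
  have h := sum_smul_eq_zero_of_irreducible ρ f hf
    (h0 _ ⟨_, _, _, inferInstance, _, hirr, rfl⟩)
  have h2 : ρ.asAlgebraHom
      (∑ g, f g • (MonoidAlgebra.single g⁻¹ 1 : MonoidAlgebra ℂ G)) = 0 := by
    rw [← h, map_sum]
    refine Finset.sum_congr rfl fun g _ => ?_
    rw [map_smul, Representation.asAlgebraHom_single_one]
  rw [← e.apply_symm_apply x, ← he, h2, LinearMap.zero_apply, map_zero]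

/-- Irreducible characters span the class functions. -/
theorem eq_zero_of_classPairing_eq_zero {G : Type} [Group G] [Fintype G] (f : G → ℂ)
    (hf : ∀ x g, f (x * g * x⁻¹) = f g)
    (h0 : ∀ χ, IsIrreducibleCharacter χ → classPairing f χ = 0) : f = 0 := by
  classical
  have := invertibleOfNonzero (natCard_complex_ne_zero G)
  have : NeZero (Nat.card G : ℂ) := ⟨natCard_complex_ne_zero G⟩
  set z : MonoidAlgebra ℂ G := ∑ g, f g • MonoidAlgebra.single g⁻¹ 1 with hz
  have key : ∀ S : Submodule (MonoidAlgebra ℂ G) (MonoidAlgebra ℂ G),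
      IsSimpleModule (MonoidAlgebra ℂ G) S → ∀ x ∈ S, z • x = 0 := fun S _ x hx =>
    congrArg Subtype.val (sum_smul_single_eq_zero_of_simple f hf h0 S ⟨x, hx⟩)
  -- By semisimplicity `1` lies in the sum of the simple left ideals, all killed by `z`. So `z = 0`,
  -- and its coefficients are the values of `f`.
  have hz0 : z • (1 : MonoidAlgebra ℂ G) = 0 := by
    have hmem : (1 : MonoidAlgebra ℂ G) ∈
        sSup {m : Submodule (MonoidAlgebra ℂ G) (MonoidAlgebra ℂ G) |
          IsSimpleModule (MonoidAlgebra ℂ G) m} := by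
      rw [IsSemisimpleModule.sSup_simples_eq_top]
      trivial
    rw [sSup_eq_iSup'] at hmem
    refine Submodule.iSup_induction _ (motive := fun x => z • x = 0) hmem
      (fun S x hx => key S.1 S.2 x hx) (smul_zero z) fun x y hx hy => ?_
    rw [smul_add, hx, hy, add_zero]
  rw [smul_eq_mul, mul_one] at hz0
  ext g
  have := congrArg (fun w : MonoidAlgebra ℂ G => w.coeff g⁻¹) hz0
  simpa [hz, MonoidAlgebra.coeff_sum, Finsupp.finsetSum_apply, Finsupp.single_apply] using this

/-- A class function whose pairings with irreducible characters are natural numbers is a proper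
character. -/
theorem isProperCharacter_of_classPairing_nat {G : Type} [Group G] [Fintype G] (f : G → ℂ)
    (hf : ∀ x g, f (x * g * x⁻¹) = f g)
    (h : ∀ χ, IsIrreducibleCharacter χ → ∃ m : ℕ, classPairing f χ = m) :
    IsProperCharacter f := by
  classical
  choose! m hm using h
  set X := (finite_irreducibleCharacter G).toFinset with hX
  have hmem : ∀ χ, χ ∈ X ↔ IsIrreducibleCharacter χ := fun χ => by simp [hX]
  have hzero : f - ∑ χ ∈ X, (m χ : ℂ) • χ = 0 := by
    refine eq_zero_of_classPairing_eq_zero _ (fun x g => ?_) fun ψ hψ => ?_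
    · simp only [Pi.sub_apply, hf, Finset.sum_apply, Pi.smul_apply]
      congr 1
      refine Finset.sum_congr rfl fun χ hχ => ?_
      obtain ⟨V, _, _, _, ρ, -, rfl⟩ := (hmem χ).1 hχ
      rw [Representation.char_conj]
    · rw [classPairing_sub, classPairing_sum_smul, hm ψ hψ,
        Finset.sum_congr rfl fun χ hχ => by
          rw [classPairing_irreducible ((hmem χ).1 hχ) hψ, mul_ite, mul_one, mul_zero]]
      rw [Finset.sum_ite_eq', if_pos ((hmem ψ).2 hψ), sub_self]
  rw [sub_eq_zero.1 hzero]
  refine AddSubmonoid.sum_mem (AddSubmonoid.closure {χ : G → ℂ | IsIrreducibleCharacter χ})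
    fun χ hχ => ?_
  rw [Nat.cast_smul_eq_nsmul]
  exact nsmul_mem (AddSubmonoid.subset_closure (by exact (hmem χ).1 hχ)) _

/-- The multiplicity of a linear character of a subgroup in a restricted representation. -/
theorem exists_nat_sum_linear_mul_character {G V : Type*} [Group G] [Fintype G] [AddCommGroup V]
    [Module ℂ V] [FiniteDimensional ℂ V] (ρ : Representation ℂ G V) (H : Subgroup G)
    [Fintype H] (ω : H →* ℂ) :
    ∃ m : ℕ, ∑ h : H, ω h * ρ.character (h : G)⁻¹ = Nat.card H * m := by
  have := invertibleOfNonzero (natCard_complex_ne_zero H)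
  let lin : Representation ℂ H ℂ := (Algebra.lmul ℂ ℂ).toMonoidHom.comp ω
  have hlin : ∀ h, lin.character h = ω h := by
    intro h
    have : lin h = ω h • (1 : ℂ →ₗ[ℂ] ℂ) := by
      ext
      simp [lin]
    rw [Representation.character, this, map_smul, LinearMap.trace_one]
    simp
  have h := Representation.card_inv_mul_sum_char_mul_char_eq_finrank
    (ρ.comp H.subtype : Representation ℂ H V) lin
  refine ⟨Module.finrank ℂ (Representation.IntertwiningMap (ρ.comp H.subtype) lin), ?_⟩
  · rw [← h, ← mul_assoc, mul_inv_cancel₀ (natCard_complex_ne_zero H), one_mul]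
    refine Finset.sum_congr rfl fun x _ => ?_
    rw [hlin]
    rfl

/-! ### Integrality of Frobenius–Schur indicators -/

/-- Entries of a power of a matrix as sums over walks. -/
theorem matrix_pow_succ_apply {d R : Type*} [Fintype d] [DecidableEq d] [CommRing R]
    (A : Matrix d d R) (m : ℕ) (x y : d) :
    (A ^ (m + 1)) x y = ∑ a : Fin m → d, ∏ i : Fin (m + 1),
      A ((Fin.cons x a : Fin (m + 1) → d) i) ((Fin.snoc a y : Fin (m + 1) → d) i) := by
  induction m generalizing x with
  | zero => simp [Fin.snoc]
  | succ m ih =>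
    rw [pow_succ', Matrix.mul_apply,
      ← (Fin.consEquiv (fun _ : Fin (m + 1) => d)).sum_comp, Fintype.sum_prod_type]
    refine Finset.sum_congr rfl fun z _ => ?_
    rw [ih, Finset.mul_sum]
    refine Finset.sum_congr rfl fun a _ => ?_
    rw [Fin.prod_univ_succ (n := m + 1)]
    have h : (Fin.snoc ((Fin.consEquiv fun _ : Fin (m + 1) => d) (z, a)) y : Fin (m + 2) → d) =
        (Fin.cons z (Fin.snoc a y : Fin (m + 1) → d) : Fin (m + 2) → d) :=
      (Fin.cons_snoc_eq_snoc_cons z a y).symm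
    rw [h]
    simp only [Fin.consEquiv_apply, Fin.cons_zero, Fin.cons_succ]

/-- The trace counts weighted closed walks, i.e. cyclic words. This is what identifies it with the
trace of a Kronecker power composed with the cyclic shift. -/
theorem trace_matrix_pow_succ {d R : Type*} [Fintype d] [DecidableEq d] [CommRing R]
    (A : Matrix d d R) (m : ℕ) :
    (A ^ (m + 1)).trace = ∑ a : Fin (m + 1) → d, ∏ i, A (a i) (a (finRotate _ i)) := by
  rw [← (Fin.consEquiv (fun _ : Fin (m + 1) => d)).sum_comp, Fintype.sum_prod_type, Matrix.trace]
  refine Finset.sum_congr rfl fun x _ => ?_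
  rw [Matrix.diag_apply, matrix_pow_succ_apply]
  refine Finset.sum_congr rfl fun a _ => ?_
  rw [Fin.snoc_eq_cons_rotate]
  rfl

/-- The Kronecker power of a matrix, indexed by functions. -/
def kronPow {d R : Type*} [CommRing R] (ι : Type*) [Fintype ι] (A : Matrix d d R) :
    Matrix (ι → d) (ι → d) R :=
  Matrix.of fun a b => ∏ i, A (a i) (b i)

theorem kronPow_mul {d R ι : Type*} [Fintype d] [CommRing R] [Fintype ι] [DecidableEq ι]
    (A B : Matrix d d R) : kronPow ι (A * B) = kronPow ι A * kronPow ι B := by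
  ext a b
  simp only [kronPow, Matrix.of_apply, Matrix.mul_apply, Finset.prod_univ_sum,
    Finset.prod_mul_distrib, Fintype.piFinset_univ]

/-- The eigenvalues are roots of `X ^ (N + 1) - X`, which is monic because `N > 0`; the trace is
their sum. -/
theorem isIntegral_trace_of_pow_succ_eq {ι : Type*} [Fintype ι] [DecidableEq ι]
    (A : Matrix ι ι ℂ) (N : ℕ) (hN : 0 < N) (hA : A ^ (N + 1) = A) : IsIntegral ℤ A.trace := by
  rw [Matrix.trace_eq_sum_roots_charpoly]
  refine IsIntegral.multiset_sum fun r hr => ?_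
  have hs : r ∈ spectrum ℂ A :=
    Matrix.mem_spectrum_of_isRoot_charpoly (Polynomial.isRoot_of_mem_roots hr)
  have h := spectrum.subset_polynomial_aeval A (Polynomial.X ^ (N + 1) - Polynomial.X)
    ⟨r, hs, rfl⟩
  have h0 : (Polynomial.aeval A) (Polynomial.X ^ (N + 1) - Polynomial.X : Polynomial ℂ) = 0 := by
    simp [hA]
  rw [h0] at h
  have : Nonempty ι := by
    by_contra hne
    rw [not_nonempty_iff] at hne
    rw [spectrum.of_subsingleton] at h
    exact h
  have h1 : r ^ (N + 1) - r = 0 := by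
    simpa using h
  refine ⟨Polynomial.X ^ (N + 1) - Polynomial.X, ?_, ?_⟩
  · refine (Polynomial.monic_X_pow (N + 1)).sub_of_left ?_
    rw [Polynomial.degree_X_pow, Polynomial.degree_X]
    exact_mod_cast (by omega : 1 < N + 1)
  · simpa using h1

/-- The higher Frobenius–Schur indicators are algebraic integers. -/
theorem isIntegral_frobeniusSchur {G V : Type*} [Group G] [Fintype G] [AddCommGroup V]
    [Module ℂ V] [FiniteDimensional ℂ V] (ρ : Representation ℂ G V) (m : ℕ) :
    IsIntegral ℤ ((Nat.card G : ℂ)⁻¹ * ∑ g, ρ.character (g ^ (m + 1))) := by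
  classical
  let b := Module.finBasis ℂ V
  let M : G →* Matrix (Fin (Module.finrank ℂ V)) (Fin (Module.finrank ℂ V)) ℂ :=
    (LinearMap.toMatrixAlgEquiv b).toAlgHom.toRingHom.toMonoidHom.comp ρ
  have hM : ∀ g, ρ.character g = (M g).trace := fun g => by
    rw [Representation.character, LinearMap.trace_eq_matrix_trace ℂ b]
    rfl
  let ι := Fin (m + 1)
  let e : Equiv.Perm (ι → Fin (Module.finrank ℂ V)) := (finRotate (m + 1)).arrowCongr (.refl _)
  have he : ∀ a i, (e.symm a) i = a (finRotate _ i) := fun a i => rfl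
  -- `C` permutes the factors of the tensor power of `V` cyclically, and `P` below projects onto the
  -- invariants of `G`. They commute, and the trace of `P * C` is the indicator.
  let C := e.permMatrix ℂ
  let P : Matrix (ι → Fin (Module.finrank ℂ V)) (ι → Fin (Module.finrank ℂ V)) ℂ :=
    (Nat.card G : ℂ)⁻¹ • ∑ g, kronPow ι (M g)
  have hP : P * P = P := by
    have h1 : ∀ g, ∑ h, kronPow ι (M g) * kronPow ι (M h) = ∑ h, kronPow ι (M h) := by
      intro g
      simp_rw [← kronPow_mul, ← map_mul]
      exact Fintype.sum_equiv (Equiv.mulLeft g) _ _ fun h => rfl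
    simp only [P]
    rw [smul_mul_smul_comm, Finset.sum_mul_sum]
    simp_rw [h1]
    rw [Finset.sum_const, Finset.card_univ, ← Nat.card_eq_fintype_card,
      ← Nat.cast_smul_eq_nsmul ℂ, smul_smul, mul_assoc,
      inv_mul_cancel₀ (natCard_complex_ne_zero G), mul_one]
  have hC : ∀ A : Matrix _ _ ℂ, Commute (kronPow ι A) C := by
    intro A
    change kronPow ι A * e.toPEquiv.toMatrix = e.toPEquiv.toMatrix * kronPow ι A
    rw [PEquiv.mul_toMatrix_toPEquiv, PEquiv.toMatrix_toPEquiv_mul]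
    ext a b
    refine Fintype.prod_equiv (finRotate (m + 1)) _ _ fun i => ?_
    simp [e, Equiv.arrowCongr]
  have hPC : Commute P C :=
    (Commute.sum_left _ _ _ fun g _ => hC (M g)).smul_left _
  have hCN : C ^ (orderOf e) = 1 := by
    have h1 : ∀ N : ℕ, C ^ N = (e ^ N).permMatrix ℂ := by
      intro N
      induction N with
      | zero => simp
      | succ N ih => rw [pow_succ, ih, pow_succ', Matrix.permMatrix_mul]
    rw [h1, pow_orderOf_eq_one, Matrix.permMatrix_one]
  have htr : (P * C).trace = (Nat.card G : ℂ)⁻¹ * ∑ g, ρ.character (g ^ (m + 1)) := by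
    simp only [P]
    rw [smul_mul_assoc, Matrix.trace_smul, Finset.sum_mul, Matrix.trace_sum, smul_eq_mul]
    congr 1
    refine Finset.sum_congr rfl fun g _ => ?_
    rw [hM, map_pow, trace_matrix_pow_succ]
    change (kronPow ι (M g) * e.toPEquiv.toMatrix).trace = _
    rw [PEquiv.mul_toMatrix_toPEquiv]
    rfl
  rw [← htr]
  refine isIntegral_trace_of_pow_succ_eq _ (orderOf e) (orderOf_pos _) ?_
  rw [hPC.mul_pow, pow_succ C, hCN, one_mul]
  congr 1
  exact (show IsIdempotentElem P from hP).pow_succ_eq _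

/-! ### Root enumerators and the criterion for properness -/

theorem rootEnumerator_conj {G : Type*} [Group G] [Finite G] (k : ℤ) (x g : G) :
    rootEnumerator G k (x * g * x⁻¹) = rootEnumerator G k g := by
  refine (Nat.card_congr ((MulAut.conj x).toEquiv.subtypeEquiv fun h => ?_)).symm
  change h ^ k = g ↔ (MulAut.conj x h) ^ k = MulAut.conj x g
  rw [← map_zpow, (MulAut.conj x).injective.eq_iff]

theorem exists_rootEnumerator_eq_pos (G : Type*) [Group G] [Finite G] (k : ℤ) :
    ∃ m : ℕ, rootEnumerator G k = rootEnumerator G ((m + 1 : ℕ) : ℤ) := by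
  obtain ⟨N, hN⟩ : ∃ N, Nat.card G = N + 1 := 
    ⟨Nat.card G - 1, (Nat.sub_add_cancel Nat.card_pos).symm⟩
  -- The new exponent is `k % |G| + |G|`; the extra `|G|` keeps it positive when `|G|` divides `k`.
  refine ⟨(k % Nat.card G).toNat + N, funext fun g => ?_⟩
  refine Nat.card_congr (Equiv.subtypeEquivRight fun h => ?_)
  have h0 : 0 ≤ k % Nat.card G := Int.emod_nonneg _ (by exact_mod_cast Nat.card_pos.ne')
  have h1 : (((k % Nat.card G).toNat + N + 1 : ℕ) : ℤ) = k % Nat.card G + Nat.card G := by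
    push_cast
    rw [Int.toNat_of_nonneg h0, hN]
    push_cast
    ring
  rw [h1, zpow_add, zpow_natCast, pow_card_eq_one', mul_one]
  conv_lhs => rw [← Int.emod_add_mul_ediv k (Nat.card G), zpow_add, zpow_mul, zpow_natCast,
    pow_card_eq_one', one_zpow, mul_one]

theorem classPairing_rootEnumerator {G : Type*} [Group G] [Fintype G] (m : ℕ) (ψ : G → ℂ) :
    classPairing (fun g => (rootEnumerator G ((m + 1 : ℕ) : ℤ) g : ℂ)) ψ =
      (Nat.card G : ℂ)⁻¹ * ∑ g, ψ (g ^ (m + 1)) := by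
  classical
  rw [classPairing]
  congr 1
  have h1 : ∀ g, (rootEnumerator G ((m + 1 : ℕ) : ℤ) g : ℂ) =
      ∑ h : G, if h ^ (m + 1) = g then 1 else 0 := by
    intro g
    simp only [rootEnumerator, zpow_natCast]
    rw [Nat.card_eq_fintype_card, Fintype.card_subtype, Finset.sum_boole]
  simp_rw [h1, Finset.sum_mul]
  rw [Finset.sum_comm]
  refine Fintype.sum_equiv (Equiv.inv G) _ _ fun h => ?_
  simp [ite_mul]

open scoped Classical in
/-- A root enumerator which is half a sum of monomial terms is a proper character: its pairings
with irreducible characters are nonnegative rationals, and algebraic integers. -/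
theorem isProperCharacter_rootEnumerator_of_monomial {G : Type} [Group G] [Finite G] (m : ℕ)
    {B : Type*} [Fintype B] (H : B → Subgroup G) (ω : B → G → ℂ) (hω1 : ∀ b, ω b 1 = 1)
    (hω : ∀ b, ∀ x ∈ H b, ∀ y ∈ H b, ω b (x * y) = ω b x * ω b y)
    (h : ∀ g, (rootEnumerator G ((m + 1 : ℕ) : ℤ) g : ℂ) =
      2⁻¹ * ∑ b, if g ∈ H b then ω b g else 0) :
    IsProperCharacter (fun g : G => (rootEnumerator G ((m + 1 : ℕ) : ℤ) g : ℂ)) := by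
  have := Fintype.ofFinite G
  refine isProperCharacter_of_classPairing_nat _
    (fun x g => by rw [rootEnumerator_conj]) fun χ hχ => ?_
  obtain ⟨V, _, _, _, ρ, -, rfl⟩ := hχ
  have hint : IsIntegral ℤ
      (classPairing (fun g => (rootEnumerator G ((m + 1 : ℕ) : ℤ) g : ℂ)) ρ.character) := by
    rw [classPairing_rootEnumerator]
    exact isIntegral_frobeniusSchur ρ m
  let w : ∀ b, H b →* ℂ := fun b =>
    { toFun := fun x => ω b x
      map_one' := hω1 b
      map_mul' := fun x y => hω b x x.2 y y.2 }
  choose c hc using fun b => exists_nat_sum_linear_mul_character ρ (H b) (w b)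
  have hrat : classPairing (fun g => (rootEnumerator G ((m + 1 : ℕ) : ℤ) g : ℂ)) ρ.character =
      (((Nat.card G : ℚ)⁻¹ * (2⁻¹ * ∑ b, (Nat.card (H b) * c b : ℚ)) : ℚ) : ℂ) := by
    rw [classPairing]
    simp_rw [h, mul_assoc, Finset.sum_mul]
    push_cast
    rw [← Finset.mul_sum, Finset.sum_comm]
    congr 2
    refine Finset.sum_congr rfl fun b _ => ?_
    rw [← hc b]
    simp_rw [ite_mul, zero_mul]
    rw [← Finset.sum_filter]
    exact Finset.sum_subtype _ (fun g => by simp) fun g => ω b g * ρ.character g⁻¹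
  rw [hrat] at hint ⊢
  set q : ℚ := (Nat.card G : ℚ)⁻¹ * (2⁻¹ * ∑ b, (Nat.card (H b) * c b : ℚ)) with hq
  have hq0 : 0 ≤ q := by positivity
  -- The factors `2⁻¹` and `|H| / |G|` leave `q` visibly rational only; a rational algebraic integer
  -- is an integer.
  have hqint : IsIntegral ℤ q :=
    (isIntegral_algebraMap_iff (algebraMap ℚ ℂ).injective).1 hint
  obtain ⟨z, hz⟩ := IsIntegrallyClosed.isIntegral_iff.1 hqint
  have hz' : (z : ℚ) = q := hz
  rw [← hz'] at hq0 ⊢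
  obtain ⟨N, rfl⟩ := Int.eq_ofNat_of_zero_le (by exact_mod_cast hq0 : 0 ≤ z)
  exact ⟨N, by simp⟩

/-! ### Dual roots of unity and the local identity -/

/-- For `t` with `j = gcd (a, t)` and `e = a / j`, the power of the standard primitive `e`-th root of
unity whose exponent is the inverse of `t / j` modulo `e`. -/
noncomputable def dualRoot (a t : ℕ) : ℂ :=
  Complex.exp (2 * Real.pi * Complex.I *
    (((((t / a.gcd t : ℕ) : ZMod (a / a.gcd t))⁻¹).val : ℂ) / ((a / a.gcd t : ℕ) : ℂ)))

theorem exp_div_eq_of_modEq {e s s' : ℕ} (he : 0 < e) (h : s ≡ s' [MOD e]) :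
    Complex.exp (2 * Real.pi * Complex.I * ((s : ℂ) / (e : ℂ))) =
      Complex.exp (2 * Real.pi * Complex.I * ((s' : ℂ) / (e : ℂ))) := by
  have key : ∀ r : ℕ, Complex.exp (2 * Real.pi * Complex.I * ((r : ℂ) / (e : ℂ))) =
      Complex.exp (2 * Real.pi * Complex.I / e) ^ r := by
    intro r
    rw [← Complex.exp_nat_mul]
    congr 1
    ring
  rw [key, key]
  have hp := Complex.isPrimitiveRoot_exp e he.ne'
  rw [← pow_mod_orderOf, ← pow_mod_orderOf (n := s'), ← hp.eq_orderOf]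
  rw [show s % e = s' % e from h]

theorem dualRoot_eq {a t s : ℕ} (ha : 0 < a) (h : t / a.gcd t * s ≡ 1 [MOD a / a.gcd t]) :
    dualRoot a t =
      Complex.exp (2 * Real.pi * Complex.I * ((s : ℂ) / ((a / a.gcd t : ℕ) : ℂ))) := by
  have hj : 0 < a.gcd t := Nat.gcd_pos_of_pos_left _ ha
  have he : 0 < a / a.gcd t := Nat.div_pos (Nat.le_of_dvd ha (Nat.gcd_dvd_left a t)) hj
  have : NeZero (a / a.gcd t) := ⟨he.ne'⟩
  refine exp_div_eq_of_modEq he ?_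
  rw [← ZMod.natCast_eq_natCast_iff, ZMod.natCast_val, ZMod.cast_id]
  refine ZMod.inv_eq_of_mul_eq_one _ _ _ ?_
  rw [← Nat.cast_mul, ← Nat.cast_one, ZMod.natCast_eq_natCast_iff]
  exact h

theorem exists_mul_modEq_one {a : ℕ} (ha : 0 < a) (t : ℕ) :
    ∃ s, t / a.gcd t * s ≡ 1 [MOD a / a.gcd t] := by
  have hj : 0 < a.gcd t := Nat.gcd_pos_of_pos_left _ ha
  have : NeZero (a / a.gcd t) := ⟨(Nat.div_pos (Nat.le_of_dvd ha (Nat.gcd_dvd_left a t)) hj).ne'⟩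
  refine ⟨(((t / a.gcd t : ℕ) : ZMod (a / a.gcd t))⁻¹).val, ?_⟩
  rw [← ZMod.natCast_eq_natCast_iff, Nat.cast_mul, ZMod.natCast_val, ZMod.cast_id, Nat.cast_one]
  exact ZMod.coe_mul_inv_eq_one _ (Nat.coprime_div_gcd_div_gcd hj).symm

theorem mul_modEq_gcd {a t s : ℕ} (h : t / a.gcd t * s ≡ 1 [MOD a / a.gcd t]) :
    t * s ≡ a.gcd t [MOD a] := by
  have h1 := h.mul_left' (c := a.gcd t)
  rwa [← mul_assoc, Nat.mul_div_cancel' (Nat.gcd_dvd_left a t),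
    Nat.mul_div_cancel' (Nat.gcd_dvd_right a t), mul_one] at h1

/-- The order recovers `gcd (a, t)`, and the power identity then recovers `t / gcd (a, t)`; together
they determine `t` modulo `a`. -/
theorem dualRoot_spec {a : ℕ} (ha : 0 < a) (t : ℕ) :
    IsPrimitiveRoot (dualRoot a t) (a / a.gcd t) ∧
      dualRoot a t ^ (t / a.gcd t) = Complex.exp (2 * Real.pi * Complex.I / ((a / a.gcd t : ℕ) : ℂ)) := by
  have hj : 0 < a.gcd t := Nat.gcd_pos_of_pos_left _ ha
  have he : 0 < a / a.gcd t := Nat.div_pos (Nat.le_of_dvd ha (Nat.gcd_dvd_left a t)) hj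
  obtain ⟨s, hmod⟩ := exists_mul_modEq_one ha t
  have hcos : s.Coprime (a / a.gcd t) :=
    Nat.Coprime.coprime_dvd_left (dvd_mul_left s (t / a.gcd t)) (by
      rw [Nat.Coprime, hmod.gcd_eq]; simp)
  rw [dualRoot_eq ha hmod]
  refine ⟨Complex.isPrimitiveRoot_exp_of_coprime _ _ he.ne' hcos, ?_⟩
  rw [← Complex.exp_nat_mul]
  have h := exp_div_eq_of_modEq he hmod
  rw [show 2 * (Real.pi : ℂ) * Complex.I / ((a / a.gcd t : ℕ) : ℂ) =
    2 * Real.pi * Complex.I * (((1 : ℕ) : ℂ) / ((a / a.gcd t : ℕ) : ℂ)) by push_cast; ring, ← h]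
  congr 1
  push_cast
  ring

theorem dualRoot_mod {a : ℕ} (ha : 0 < a) (t : ℕ) : dualRoot a (t % a) = dualRoot a t := by
  have hg : a.gcd (t % a) = a.gcd t := by
    rw [Nat.gcd_comm, ← Nat.gcd_rec]
  have hj : 0 < a.gcd t := Nat.gcd_pos_of_pos_left _ ha
  have hmod : t % a / a.gcd t ≡ t / a.gcd t [MOD a / a.gcd t] := by
    refine Nat.ModEq.mul_left_cancel' (c := a.gcd t) hj.ne' ?_
    rw [Nat.mul_div_cancel' ((Nat.dvd_mod_iff (Nat.gcd_dvd_left a t)).2 (Nat.gcd_dvd_right a t)),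
      Nat.mul_div_cancel' (Nat.gcd_dvd_right a t), Nat.mul_div_cancel' (Nat.gcd_dvd_left a t)]
    exact Nat.mod_modEq t a
  rw [dualRoot, dualRoot, hg, (ZMod.natCast_eq_natCast_iff _ _ _).2 hmod]

theorem dualRoot_injOn {a : ℕ} (ha : 0 < a) :
    Set.InjOn (dualRoot a) (Finset.range a : Set ℕ) := by
  intro t ht u hu htu
  simp only [Finset.coe_range, Set.mem_Iio] at ht hu
  obtain ⟨h1, h2⟩ := dualRoot_spec ha t
  obtain ⟨h3, h4⟩ := dualRoot_spec ha u
  rw [← htu] at h3 h4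
  have he := h1.unique h3
  have hj : a.gcd t = a.gcd u := by
    rw [← Nat.div_div_self (Nat.gcd_dvd_left a t) ha.ne', he,
      Nat.div_div_self (Nat.gcd_dvd_left a u) ha.ne']
  rw [← hj] at h4
  have hlt : ∀ v, v < a → a.gcd t ∣ v → v / a.gcd t < a / a.gcd t := fun v hv hd =>
    Nat.div_lt_div_of_lt_of_dvd (Nat.gcd_dvd_left a t) hv
  have h5 := h1.pow_inj (hlt t ht (Nat.gcd_dvd_right a t))
    (hlt u hu (hj ▸ Nat.gcd_dvd_right a u)) (h2.trans h4.symm)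
  rw [← Nat.mul_div_cancel' (Nat.gcd_dvd_right a t), h5,
    Nat.mul_div_cancel' (hj ▸ Nat.gcd_dvd_right a u)]

theorem card_filter_dvd_mul {a : ℕ} (ha : 0 < a) (c : ℕ) :
    ((Finset.range a).filter fun t => a ∣ t * c).card = a.gcd c := by
  have hg : 0 < a.gcd c := Nat.gcd_pos_of_pos_left _ ha
  have ha' : a / a.gcd c * a.gcd c = a := Nat.div_mul_cancel (Nat.gcd_dvd_left a c)
  have he : 0 < a / a.gcd c := Nat.div_pos (Nat.le_of_dvd ha (Nat.gcd_dvd_left a c)) hg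
  have : ((Finset.range a).filter fun t => a ∣ t * c) =
      (Finset.range (a.gcd c)).image fun i => a / a.gcd c * i := by
    ext t
    simp only [Finset.mem_filter, Finset.mem_range, Finset.mem_image]
    have hiff : a ∣ t * c ↔ a / a.gcd c ∣ t := by
      rw [← Nat.dvd_mul_gcd_iff_dvd_mul, ← Nat.mul_dvd_mul_iff_right (b := t) hg, ha']
    rw [hiff]
    constructor
    · rintro ⟨ht, i, rfl⟩
      refine ⟨i, ?_, rfl⟩
      rw [← ha'] at ht
      exact lt_of_mul_lt_mul_left (by rwa [ha'] at ht ⊢) he.le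
    · rintro ⟨i, hi, rfl⟩
      refine ⟨?_, dvd_mul_right _ _⟩
      conv_rhs => rw [← ha']
      exact (Nat.mul_lt_mul_left he).2 hi
  rw [this, Finset.card_image_of_injective _ fun i j h => Nat.eq_of_mul_eq_mul_left he h,
    Finset.card_range]

/-- On the solutions of `a ∣ t * c` the dual roots run exactly once through all `gcd (a, c)`-th
roots of unity. Their sum is `1` if `c` is invertible modulo `a`, and `0` otherwise, which is also
the number of inverses of `c`. -/
theorem sum_dualRoot {a : ℕ} (ha : 0 < a) (c : ℕ) :
    ∑ t ∈ (Finset.range a).filter (fun t => a ∣ t * c), dualRoot a t =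
      ((Finset.range a).filter fun t => t * c ≡ 1 [MOD a]).card := by
  classical
  have hg : 0 < a.gcd c := Nat.gcd_pos_of_pos_left _ ha
  set S := (Finset.range a).filter fun t => a ∣ t * c with hS
  have hinj : Set.InjOn (dualRoot a) S := (dualRoot_injOn ha).mono (by
    intro t ht; exact (Finset.mem_filter.1 ht).1)
  have hmaps : ∀ t ∈ S, dualRoot a t ^ a.gcd c = 1 := by
    intro t ht
    obtain ⟨h1, -⟩ := dualRoot_spec ha t
    have hj : 0 < a.gcd t := Nat.gcd_pos_of_pos_left _ ha
    have h2 : a / a.gcd t ∣ c := by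
      have h3 : a / a.gcd t ∣ t / a.gcd t * c := by
        refine Nat.dvd_of_mul_dvd_mul_left hj ?_
        rw [← mul_assoc, Nat.mul_div_cancel' (Nat.gcd_dvd_left a t),
          Nat.mul_div_cancel' (Nat.gcd_dvd_right a t)]
        exact (Finset.mem_filter.1 ht).2
      exact (Nat.coprime_div_gcd_div_gcd hj).dvd_of_dvd_mul_left h3
    exact (h1.pow_eq_one_iff_dvd _).2
      (Nat.dvd_gcd (Nat.div_dvd_of_dvd (Nat.gcd_dvd_left a t)) h2)
  -- Inclusion plus equal cardinality: both sets have `gcd (a, c)` elements.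
  have himg : S.image (dualRoot a) = Polynomial.nthRootsFinset (a.gcd c) (1 : ℂ) := by
    refine Finset.eq_of_subset_of_card_le (fun x hx => ?_) ?_
    · obtain ⟨t, ht, rfl⟩ := Finset.mem_image.1 hx
      exact (Polynomial.mem_nthRootsFinset hg _).2 (hmaps t ht)
    · rw [Finset.card_image_of_injOn hinj, card_filter_dvd_mul ha,
        (Complex.isPrimitiveRoot_exp _ hg.ne').card_nthRootsFinset]
  have hζ := Complex.isPrimitiveRoot_exp _ hg.ne'
  set ζ := Complex.exp (2 * Real.pi * Complex.I / (a.gcd c : ℕ)) with hζ'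
  have hroots : (Finset.range (a.gcd c)).image (fun i => ζ ^ i) =
      Polynomial.nthRootsFinset (a.gcd c) (1 : ℂ) := by
    refine Finset.eq_of_subset_of_card_le (fun x hx => ?_) ?_
    · obtain ⟨i, -, rfl⟩ := Finset.mem_image.1 hx
      rw [Polynomial.mem_nthRootsFinset hg, ← pow_mul, mul_comm, pow_mul, hζ.pow_eq_one, one_pow]
    · rw [Finset.card_image_of_injOn, hζ.card_nthRootsFinset, Finset.card_range]
      exact hζ.injOn_pow
  have hsum : ∑ t ∈ S, dualRoot a t = ∑ i ∈ Finset.range (a.gcd c), ζ ^ i := by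
    rw [← Finset.sum_image (f := fun x : ℂ => x) hinj, himg, ← hroots,
      Finset.sum_image hζ.injOn_pow]
  rw [hsum]
  by_cases h1 : a.gcd c = 1
  · rw [h1, Finset.sum_range_one, pow_zero]
    norm_cast
    rw [eq_comm, Finset.card_eq_one]
    have : NeZero a := ⟨ha.ne'⟩
    refine ⟨((c : ZMod a)⁻¹).val, ?_⟩
    have hc : (c : ZMod a) * (c : ZMod a)⁻¹ = 1 :=
      ZMod.coe_mul_inv_eq_one _ (Nat.Coprime.symm h1)
    ext t
    rw [Finset.mem_filter, Finset.mem_range, Finset.mem_singleton,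
      ← ZMod.natCast_eq_natCast_iff, Nat.cast_mul, Nat.cast_one]
    constructor
    · rintro ⟨hta, ht⟩
      rw [ZMod.inv_eq_of_mul_eq_one _ _ _ (by rwa [mul_comm] at ht), ZMod.val_natCast_of_lt hta]
    · rintro rfl
      refine ⟨ZMod.val_lt _, ?_⟩
      rw [ZMod.natCast_val, ZMod.cast_id, mul_comm, hc]
  · rw [hζ.geom_sum_eq_zero (by omega), eq_comm, Nat.cast_eq_zero, Finset.card_eq_zero,
      Finset.filter_eq_empty_iff]
    intro t _ ht
    refine h1 (Nat.dvd_one.1 ?_)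
    have h2 : t * c ≡ 1 [MOD a.gcd c] := ht.of_dvd (Nat.gcd_dvd_left a c)
    exact (h2.dvd_iff dvd_rfl).1 (dvd_mul_of_dvd_right (Nat.gcd_dvd_right a c) t)

theorem sum_range_shift {a : ℕ} {f : ℕ → ℂ} (hf : ∀ t, f (t % a) = f t) (t : ℕ) :
    ∑ i ∈ Finset.range a, f (t + i) = ∑ i ∈ Finset.range a, f i := by
  induction t with
  | zero => simp
  | succ t ih =>
    rw [← ih]
    have h1 := Finset.sum_range_succ (fun i => f (t + i)) a
    have h2 := Finset.sum_range_succ' (fun i => f (t + i)) a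
    have h3 : f (t + a) = f (t + 0) := by
      rw [← hf (t + a), Nat.add_mod_right, hf, add_zero]
    rw [h1, h3] at h2
    rw [add_right_cancel h2]
    refine Finset.sum_congr rfl fun i _ => ?_
    congr 1
    ring

/-- For one joint orbit with `b` cycles of length `a` this compares the two sides of the root count,
as the twist runs over a full residue system. -/
theorem sum_local_weights {a : ℕ} (ha : 0 < a) (b k t : ℕ) :
    (∑ i ∈ Finset.range a,
      if b ∣ k ∧ a ∣ (t + i) * (k / b) then dualRoot a (t + i) else 0) =
    ∑ i ∈ Finset.range a, if b ∣ k ∧ (t + i) * (k / b) ≡ 1 [MOD a] then (1 : ℂ) else 0 := by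
  rw [sum_range_shift (f := fun t => if b ∣ k ∧ a ∣ t * (k / b) then dualRoot a t else 0),
    sum_range_shift
      (f := fun t => if b ∣ k ∧ t * (k / b) ≡ 1 [MOD a] then (1 : ℂ) else 0)]
  · by_cases hb : b ∣ k
    · simp only [hb, true_and]
      rw [← Finset.sum_filter, sum_dualRoot ha, Finset.sum_boole]
    · simp [hb]
  · intro t
    have h : t % a * (k / b) ≡ t * (k / b) [MOD a] := (Nat.mod_modEq t a).mul_right _
    have h1 : t % a * (k / b) ≡ 1 [MOD a] ↔ t * (k / b) ≡ 1 [MOD a] := ⟨h.symm.trans, h.trans⟩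
    simp only [h1]
  · intro t
    have h : t % a * (k / b) ≡ t * (k / b) [MOD a] := (Nat.mod_modEq t a).mul_right _
    simp only [h.dvd_iff dvd_rfl, dualRoot_mod ha]

/-! ### Commuting permutations and their twists -/

theorem perm_pow_apply_eq_iff {α : Type*} [Finite α] (σ : Equiv.Perm α) (x : α) (p q : ℕ) :
    (σ ^ p) x = (σ ^ q) x ↔ p ≡ q [MOD Function.minimalPeriod σ x] := by
  have hpos : 0 < Function.minimalPeriod σ x :=
    Function.minimalPeriod_pos_of_mem_periodicPts
      (Function.Injective.mem_periodicPts σ.injective x)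
  rw [← Equiv.Perm.iterate_eq_pow, ← Equiv.Perm.iterate_eq_pow,
    ← Function.iterate_mod_minimalPeriod_eq, ← Function.iterate_mod_minimalPeriod_eq (n := q),
    Function.iterate_eq_iterate_iff_of_lt_minimalPeriod (Nat.mod_lt _ hpos) (Nat.mod_lt _ hpos)]
  rfl

theorem minimalPeriod_perm_pos {α : Type*} [Finite α] (σ : Equiv.Perm α) (x : α) :
    0 < Function.minimalPeriod σ x :=
  Function.minimalPeriod_pos_of_mem_periodicPts
    (Function.Injective.mem_periodicPts σ.injective x)

theorem minimalPeriod_perm_commute {α : Type*} {σ h : Equiv.Perm α} (hc : Commute σ h) (x : α) :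
    Function.minimalPeriod h (σ x) = Function.minimalPeriod h x := by
  refine Function.minimalPeriod_eq_minimalPeriod_iff.2 fun n => ?_
  rw [Function.IsPeriodicPt, Function.IsPeriodicPt, Function.IsFixedPt, Function.IsFixedPt,
    Equiv.Perm.iterate_eq_pow, ← Equiv.Perm.mul_apply, ← (hc.pow_right n).eq,
    Equiv.Perm.mul_apply, σ.injective.eq_iff]

/-- The number `b` of `σ`-cycles in the orbit of `x` under commuting permutations `σ` and `h`, and
the twist `t` by which `h ^ b` acts on the `σ`-cycle of `x`. -/
structure IsTwist {α : Type*} (σ h : Equiv.Perm α) (x : α) (b t : ℕ) : Prop where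
  pos : 0 < b
  pow_apply : (h ^ b) x = (σ ^ t) x
  not_sameCycle : ∀ q, 0 < q → q < b → ¬ σ.SameCycle x ((h ^ q) x)

theorem exists_isTwist {α : Type*} [Finite α] (σ h : Equiv.Perm α) (x : α) :
    ∃ b t, IsTwist σ h x b t := by
  classical
  have hex : ∃ b, 0 < b ∧ σ.SameCycle x ((h ^ b) x) :=
    ⟨orderOf h, orderOf_pos h, by rw [pow_orderOf_eq_one]; exact .refl _ _⟩
  obtain ⟨t, ht⟩ := (Nat.find_spec hex).2.exists_nat_pow_eq
  exact ⟨Nat.find hex, t, (Nat.find_spec hex).1, ht.symm,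
    fun q h1 h2 h3 => Nat.find_min hex h2 ⟨h1, h3⟩⟩

namespace IsTwist

variable {α : Type*} {σ h : Equiv.Perm α} {x : α} {b t : ℕ}

theorem pow_mul_apply (hw : IsTwist σ h x b t) (hc : Commute σ h) (r : ℕ) :
    (h ^ (b * r)) x = (σ ^ (t * r)) x := by
  induction r with
  | zero => simp
  | succ r ih =>
    rw [mul_add_one, pow_add, Equiv.Perm.mul_apply, hw.pow_apply,
      ← Equiv.Perm.mul_apply, ← (hc.pow_pow t (b * r)).eq, Equiv.Perm.mul_apply, ih,
      ← Equiv.Perm.mul_apply, ← pow_add]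
    congr 2
    ring

/-- Reducing `q` modulo `b` and using the minimality of `b` forces `b ∣ q`; then `h ^ q` acts on `x`
as `σ ^ (t * (q / b))`. -/
theorem pow_apply_eq_iff [Finite α] (hw : IsTwist σ h x b t) (hc : Commute σ h) (p q : ℕ) :
    (h ^ q) x = (σ ^ p) x ↔
      b ∣ q ∧ t * (q / b) ≡ p [MOD Function.minimalPeriod σ x] := by
  constructor
  · intro heq
    have hb : b ∣ q := by
      by_contra hb
      have hlt := Nat.mod_lt q hw.pos
      refine hw.not_sameCycle (q % b) (Nat.pos_of_ne_zero fun h0 => hb (Nat.dvd_of_mod_eq_zero h0))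
        hlt ?_
      have h1 : (σ ^ (t * (q / b))) ((h ^ (q % b)) x) = (σ ^ p) x := by
        rw [← heq, ← Equiv.Perm.mul_apply, (hc.pow_pow _ _).eq, Equiv.Perm.mul_apply,
          ← hw.pow_mul_apply hc, ← Equiv.Perm.mul_apply, ← pow_add, Nat.mod_add_div]
      have h2 : σ.SameCycle x ((σ ^ (t * (q / b))) ((h ^ (q % b)) x)) := by
        rw [h1]
        exact Equiv.Perm.sameCycle_pow_right.2 (.refl _ _)
      exact Equiv.Perm.sameCycle_pow_right.1 h2
    refine ⟨hb, ?_⟩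
    rw [← perm_pow_apply_eq_iff, ← hw.pow_mul_apply hc, Nat.mul_div_cancel' hb, heq]
  · rintro ⟨hb, hm⟩
    rw [← (perm_pow_apply_eq_iff σ x _ _).2 hm, ← hw.pow_mul_apply hc, Nat.mul_div_cancel' hb]

theorem pow_apply_eq_self_iff [Finite α] (hw : IsTwist σ h x b t) (hc : Commute σ h) (q : ℕ) :
    (h ^ q) x = x ↔ b ∣ q ∧ Function.minimalPeriod σ x ∣ t * (q / b) := by
  have := hw.pow_apply_eq_iff hc 0 q
  rw [pow_zero, Equiv.Perm.one_apply, Nat.modEq_zero_iff_dvd] at this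
  exact this

theorem minimalPeriod_eq [Finite α] (hw : IsTwist σ h x b t) (hc : Commute σ h) :
    Function.minimalPeriod h x =
      b * (Function.minimalPeriod σ x / (Function.minimalPeriod σ x).gcd t) := by
  set a := Function.minimalPeriod σ x with ha
  have hapos : 0 < a := minimalPeriod_perm_pos σ x
  have hj : 0 < a.gcd t := Nat.gcd_pos_of_pos_left _ hapos
  have key : ∀ q, Function.minimalPeriod h x ∣ q ↔ b * (a / a.gcd t) ∣ q := by
    intro q
    rw [← Function.isPeriodicPt_iff_minimalPeriod_dvd, Function.IsPeriodicPt, Function.IsFixedPt,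
      Equiv.Perm.iterate_eq_pow, hw.pow_apply_eq_self_iff hc]
    have h1 : ∀ r, a ∣ t * r ↔ a / a.gcd t ∣ r := by
      intro r
      rw [← (Nat.coprime_div_gcd_div_gcd hj).dvd_mul_left (n := r),
        ← Nat.mul_dvd_mul_iff_left (b := a / a.gcd t) hj, ← mul_assoc,
        Nat.mul_div_cancel' (Nat.gcd_dvd_left a t), Nat.mul_div_cancel' (Nat.gcd_dvd_right a t)]
    rw [← ha, h1]
    constructor
    · rintro ⟨hb, hd⟩
      rw [← Nat.mul_div_cancel' hb]
      exact Nat.mul_dvd_mul_left b hd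
    · intro hd
      refine ⟨(Nat.dvd_mul_right _ _).trans hd, ?_⟩
      obtain ⟨r, rfl⟩ := hd
      rw [mul_assoc, Nat.mul_div_cancel_left _ hw.pos]
      exact Nat.dvd_mul_right _ _
  exact Nat.dvd_antisymm ((key _).2 dvd_rfl) ((key _).1 dvd_rfl)

/-- The multiples of `t` modulo `a` are the multiples of `gcd (a, t)`. Hence the joint orbit
consists of `gcd (a, t)` cycles of `h`, which `σ` permutes cyclically. -/
theorem sameCycle_iff [Finite α] (hw : IsTwist σ h x b t) (hc : Commute σ h) (p : ℕ) :
    h.SameCycle x ((σ ^ p) x) ↔ (Function.minimalPeriod σ x).gcd t ∣ p := by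
  set a := Function.minimalPeriod σ x with ha
  constructor
  · intro hs
    obtain ⟨q, hq⟩ := hs.exists_nat_pow_eq
    obtain ⟨-, h2⟩ := (hw.pow_apply_eq_iff hc p q).1 hq
    exact ((h2.of_dvd (Nat.gcd_dvd_left a t)).dvd_iff dvd_rfl).1
      (dvd_mul_of_dvd_left (Nat.gcd_dvd_right a t) _)
  · rintro ⟨r, rfl⟩
    obtain ⟨s, hs⟩ := exists_mul_modEq_one (minimalPeriod_perm_pos σ x) t
    have h1 : (h ^ (b * (s * r))) x = (σ ^ (a.gcd t * r)) x := by
      rw [hw.pow_mul_apply hc, perm_pow_apply_eq_iff, ← mul_assoc]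
      exact (mul_modEq_gcd hs).mul_right r
    rw [← h1]
    exact Equiv.Perm.sameCycle_pow_right.2 (.refl _ _)

/-- The roles of `σ` and `h` are exchanged: after `gcd (a, t)` steps `σ` returns to the `h`-cycle of
`x`, having rotated it by `b * s`, where `s` inverts `t / gcd (a, t)` modulo `a / gcd (a, t)`. The
cycle length also contains the factor `b`, which cancels. -/
theorem exists_dual [Finite α] (hw : IsTwist σ h x b t) (hc : Commute σ h) :
    ∃ s : ℕ, (σ ^ (Function.minimalPeriod σ x).gcd t) x = (h ^ s) x ∧
      Complex.exp (2 * Real.pi * Complex.I * ((s : ℂ) / (Function.minimalPeriod h x : ℂ))) =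
        dualRoot (Function.minimalPeriod σ x) t := by
  obtain ⟨s, hs⟩ := exists_mul_modEq_one (minimalPeriod_perm_pos σ x) t
  refine ⟨b * s, ?_, ?_⟩
  · rw [hw.pow_mul_apply hc, perm_pow_apply_eq_iff]
    exact (mul_modEq_gcd hs).symm
  · rw [dualRoot_eq (minimalPeriod_perm_pos σ x) hs, hw.minimalPeriod_eq hc]
    have hb : (b : ℂ) ≠ 0 := by exact_mod_cast hw.pos.ne'
    push_cast
    rw [mul_div_mul_left _ _ hb]

end IsTwist

/-! ### A linear character of the centralizer -/

section CycleCharacter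

variable {α : Type*}

/-- The primitive root of unity attached to the cycle of `x`, raised to the power `s`. -/
noncomputable def cycleRoot (h : Equiv.Perm α) (x : α) (s : ℕ) : ℂ :=
  Complex.exp (2 * Real.pi * Complex.I * ((s : ℂ) / (Function.minimalPeriod h x : ℂ)))

theorem cycleRoot_congr [Finite α] {h : Equiv.Perm α} {x y : α} {s s' : ℕ}
    (hxy : Function.minimalPeriod h x = Function.minimalPeriod h y)
    (hs : (h ^ s) x = (h ^ s') x) : cycleRoot h x s = cycleRoot h y s' := by
  rw [cycleRoot, cycleRoot, ← hxy]
  exact exp_div_eq_of_modEq (minimalPeriod_perm_pos h x) ((perm_pow_apply_eq_iff h x s s').1 hs)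

theorem cycleRoot_add (h : Equiv.Perm α) (x : α) (s s' : ℕ) :
    cycleRoot h x (s + s') = cycleRoot h x s * cycleRoot h x s' := by
  rw [cycleRoot, cycleRoot, cycleRoot, ← Complex.exp_add]
  congr 1
  push_cast
  ring

theorem cycleRoot_ne_zero (h : Equiv.Perm α) (x : α) (s : ℕ) : cycleRoot h x s ≠ 0 :=
  Complex.exp_ne_zero _

/-- A labelling of the points by roots of unity such that `h` rotates the labels on each cycle. -/
theorem exists_cycleLabel [Finite α] (h : Equiv.Perm α) :
    ∃ l : α → ℂ, (∀ x, l x ≠ 0) ∧ ∀ x s, l ((h ^ s) x) = cycleRoot h x s * l x := by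
  have hex : ∀ x, ∃ n : ℕ, (h ^ n) (Quotient.mk (Equiv.Perm.SameCycle.setoid h) x).out = x :=
    fun x => (show h.SameCycle _ x from Quotient.exact (s := Equiv.Perm.SameCycle.setoid h)
      (Quotient.out_eq (Quotient.mk _ x))).exists_nat_pow_eq
  choose n hn using hex
  have hper : ∀ (s : ℕ) y, Function.minimalPeriod h ((h ^ s) y) = Function.minimalPeriod h y :=
    fun s y => minimalPeriod_perm_commute ((Commute.refl h).pow_left s) y
  -- The label of `x` records its distance `n x` along the cycle from a chosen base point.
  refine ⟨fun x => cycleRoot h x (n x), fun x => cycleRoot_ne_zero _ _ _, fun x s => ?_⟩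
  have hmk : Quotient.mk (Equiv.Perm.SameCycle.setoid h) ((h ^ s) x) =
      Quotient.mk (Equiv.Perm.SameCycle.setoid h) x :=
    Quotient.sound (show h.SameCycle _ _ from Equiv.Perm.sameCycle_pow_left.2 (.refl _ _))
  have h1 := hn ((h ^ s) x)
  have h2 := hn x
  rw [hmk] at h1
  set r := (Quotient.mk (Equiv.Perm.SameCycle.setoid h) x).out with hr
  have hxr : Function.minimalPeriod h x = Function.minimalPeriod h r := by
    conv_lhs => rw [← h2, hper]
  simp only
  rw [← cycleRoot_add, cycleRoot_congr (y := r) (s' := n ((h ^ s) x)) ((hper _ _).trans hxr) rfl,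
    cycleRoot_congr (y := r) (s' := s + n x) hxr rfl]
  refine cycleRoot_congr rfl ?_
  rw [h1, pow_add, Equiv.Perm.mul_apply, h2]

/-- A choice of labelling as in `exists_cycleLabel`. -/
noncomputable def cycleLabel [Finite α] (h : Equiv.Perm α) : α → ℂ := (exists_cycleLabel h).choose

theorem cycleLabel_ne_zero [Finite α] (h : Equiv.Perm α) (x : α) : cycleLabel h x ≠ 0 :=
  (exists_cycleLabel h).choose_spec.1 x

theorem cycleLabel_pow_apply [Finite α] (h : Equiv.Perm α) (x : α) (s : ℕ) :
    cycleLabel h ((h ^ s) x) = cycleRoot h x s * cycleLabel h x :=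
  (exists_cycleLabel h).choose_spec.2 x s

/-- The rotation of the labels when `σ` moves the cycle of `x` under `h`. -/
noncomputable def labelShift [Finite α] (h σ : Equiv.Perm α) (x : α) : ℂ :=
  cycleLabel h (σ x) / cycleLabel h x

/-- Moving along the `h`-cycle multiplies numerator and denominator by the same root of unity, since
`σ` carries it to a cycle of equal length. -/
theorem labelShift_sameCycle [Finite α] {h σ : Equiv.Perm α} (hc : Commute σ h) {x y : α}
    (hxy : h.SameCycle x y) : labelShift h σ x = labelShift h σ y := by
  obtain ⟨s, rfl⟩ := hxy.exists_nat_pow_eq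
  rw [labelShift, labelShift, ← Equiv.Perm.mul_apply, (hc.pow_right s).eq, Equiv.Perm.mul_apply,
    cycleLabel_pow_apply, cycleLabel_pow_apply,
    cycleRoot_congr (s' := s) (minimalPeriod_perm_commute hc x) rfl,
    mul_div_mul_left _ _ (cycleRoot_ne_zero _ _ _)]

open scoped Classical in
/-- The linear character of the centralizer of `h`, trivial on permutations of cycles, which is
faithful on each cycle. -/
noncomputable def cycleCharacter [Fintype α] (h σ : Equiv.Perm α) : ℂ :=
  ∏ q : Quotient (Equiv.Perm.SameCycle.setoid h), labelShift h σ q.out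

theorem cycleCharacter_one [Fintype α] (h : Equiv.Perm α) : cycleCharacter h 1 = 1 :=
  Finset.prod_eq_one fun _ _ => div_self (cycleLabel_ne_zero _ _)

theorem sameCycle_apply_iff {h σ : Equiv.Perm α} (hc : Commute σ h) (x y : α) :
    h.SameCycle (σ x) (σ y) ↔ h.SameCycle x y := by
  have := Equiv.Perm.sameCycle_conj (f := h) (g := σ) (x := σ x) (y := σ y)
  rw [hc.eq, mul_inv_cancel_right] at this
  simpa using this

/-- The shifts satisfy a cocycle identity, and `τ` permutes the cycles of `h`, so the product of the
shifts of `σ` may be reindexed by `τ`. -/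
theorem cycleCharacter_mul [Fintype α] {h σ τ : Equiv.Perm α} (hσ : Commute σ h) (hτ : Commute τ h) :
    cycleCharacter h (σ * τ) = cycleCharacter h σ * cycleCharacter h τ := by
  classical
  let e : Equiv.Perm (Quotient (Equiv.Perm.SameCycle.setoid h)) :=
    Quotient.congr τ fun x y => (sameCycle_apply_iff hτ x y).symm
  have h1 : cycleCharacter h σ = ∏ q, labelShift h σ (e q).out := by
    rw [cycleCharacter]
    exact Fintype.prod_equiv e.symm _ _ fun q => by rw [e.apply_symm_apply]
  rw [h1, cycleCharacter, cycleCharacter, ← Finset.prod_mul_distrib]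
  refine Finset.prod_congr rfl fun q _ => ?_
  have h2 : labelShift h σ (e q).out = labelShift h σ (τ q.out) := by
    refine labelShift_sameCycle hσ (Quotient.exact (s := Equiv.Perm.SameCycle.setoid h) ?_)
    rw [Quotient.out_eq]
    conv_lhs => rw [← Quotient.out_eq q]
    rfl
  rw [h2, labelShift, labelShift, labelShift, Equiv.Perm.mul_apply,
    div_mul_div_cancel₀ (cycleLabel_ne_zero _ _)]

end CycleCharacter

/-! ### Joint orbits and factorization of the character -/

/-- `x` and `y` lie in the same orbit of the group generated by commuting `σ` and `h`. -/
def JointOrbit {α : Type*} (σ h : Equiv.Perm α) (x y : α) : Prop :=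
  ∃ q : ℕ, σ.SameCycle ((h ^ q) x) y

theorem sameCycle_map {α : Type*} {σ h : Equiv.Perm α} (hc : Commute σ h) {x y : α}
    (hxy : σ.SameCycle x y) : σ.SameCycle (h x) (h y) :=
  (sameCycle_apply_iff hc.symm x y).2 hxy

namespace JointOrbit

variable {α : Type*} {σ h : Equiv.Perm α}

theorem refl (σ h : Equiv.Perm α) (x : α) : JointOrbit σ h x x := ⟨0, .refl _ _⟩

theorem of_sameCycle {x y : α} (hxy : σ.SameCycle x y) : JointOrbit σ h x y := ⟨0, hxy⟩

theorem pow_apply (x : α) (q : ℕ) : JointOrbit σ h x ((h ^ q) x) := ⟨q, .refl _ _⟩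

theorem trans (hc : Commute σ h) {x y z : α} (hxy : JointOrbit σ h x y)
    (hyz : JointOrbit σ h y z) : JointOrbit σ h x z := by
  obtain ⟨q, hq⟩ := hxy
  obtain ⟨r, hr⟩ := hyz
  refine ⟨r + q, ?_⟩
  rw [pow_add, Equiv.Perm.mul_apply]
  exact (sameCycle_map (hc.pow_right r) hq).trans hr

theorem symm [Finite α] (hc : Commute σ h) {x y : α} (hxy : JointOrbit σ h x y) :
    JointOrbit σ h y x := by
  obtain ⟨q, hq⟩ := hxy
  refine ⟨q * (orderOf h - 1), ?_⟩
  have h1 := sameCycle_map (hc.pow_right (q * (orderOf h - 1))) hq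
  have h2 : q * (orderOf h - 1) + q = orderOf h * q := by
    obtain ⟨N, hN⟩ : ∃ N, orderOf h = N + 1 := ⟨_, (Nat.sub_add_cancel (orderOf_pos h)).symm⟩
    rw [hN, Nat.add_sub_cancel]
    ring
  rw [← Equiv.Perm.mul_apply, ← pow_add, h2, pow_mul, pow_orderOf_eq_one, one_pow,
    Equiv.Perm.one_apply] at h1
  exact h1.symm

end JointOrbit

theorem sameCycle_pow_of_sameCycle {α : Type*} {σ h h' : Equiv.Perm α} (hc : Commute σ h)
    (hh : ∀ x, σ.SameCycle (h x) (h' x)) (q : ℕ) (x : α) :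
    σ.SameCycle ((h ^ q) x) ((h' ^ q) x) := by
  induction q with
  | zero => exact .refl _ _
  | succ q ih =>
    rw [pow_succ', pow_succ', Equiv.Perm.mul_apply, Equiv.Perm.mul_apply]
    exact (sameCycle_map hc ih).trans (hh _)

/-- A representative of the joint orbit of `x`. -/
noncomputable def orbitRep {α : Type*} (σ h : Equiv.Perm α) (x : α) : α :=
  @Classical.epsilon α ⟨x⟩ (JointOrbit σ h x)

theorem jointOrbit_orbitRep {α : Type*} (σ h : Equiv.Perm α) (x : α) :
    JointOrbit σ h x (orbitRep σ h x) :=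
  @Classical.epsilon_spec α (JointOrbit σ h x) ⟨x, .refl σ h x⟩

theorem orbitRep_eq {α : Type*} [Finite α] {σ h : Equiv.Perm α} (hc : Commute σ h) {x y : α}
    (hxy : JointOrbit σ h x y) : orbitRep σ h x = orbitRep σ h y := by
  have h1 : JointOrbit σ h x = JointOrbit σ h y :=
    funext fun z => propext ⟨(hxy.symm hc).trans hc, hxy.trans hc⟩
  simp only [orbitRep, h1]

/-- The orbits depend only on how `h` permutes the `σ`-cycles, and the representative is chosen as a
function of the orbit predicate. So representatives do not move when `h` is modified by rotations of
`σ`-cycles. -/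
theorem orbitRep_congr {α : Type*} {σ h h' : Equiv.Perm α} (hc : Commute σ h)
    (hh : ∀ x, σ.SameCycle (h x) (h' x)) : orbitRep σ h = orbitRep σ h' := by
  funext x
  have h1 : JointOrbit σ h x = JointOrbit σ h' x := by
    funext z
    refine propext (exists_congr fun q => ?_)
    have := sameCycle_pow_of_sameCycle hc hh q x
    exact ⟨this.symm.trans, this.trans⟩
  simp only [orbitRep, h1]

/-- A map commuting with `σ` and `h` is determined on each joint orbit by its value at one point. -/
theorem perm_eq_iff_orbitRep {α : Type*} [Finite α] {σ h f g : Equiv.Perm α} (hc : Commute σ h)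
    (hσf : Commute σ f) (hσg : Commute σ g) (hhf : Commute h f) (hhg : Commute h g) :
    f = g ↔ ∀ x, orbitRep σ h x = x → f x = g x := by
  refine ⟨fun hfg x _ => by rw [hfg], fun H => Equiv.ext fun y => ?_⟩
  have h1 := jointOrbit_orbitRep σ h y
  have h2 : orbitRep σ h (orbitRep σ h y) = orbitRep σ h y := (orbitRep_eq hc h1).symm
  have h3 := H _ h2
  obtain ⟨q, hq⟩ := h1.symm hc
  obtain ⟨p, hp⟩ := hq.exists_nat_pow_eq
  have key : ∀ {k : Equiv.Perm α}, Commute σ k → Commute h k → ∀ z,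
      k ((σ ^ p) ((h ^ q) z)) = (σ ^ p) ((h ^ q) (k z)) := by
    intro k h4 h5 z
    have := ((h4.pow_left p).mul_left (h5.pow_left q)).symm.eq
    exact congrArg (fun e : Equiv.Perm α => e z) this
  rw [← hp, key hσf hhf, key hσg hhg, h3]

theorem prod_range_div_of_ne_zero (f : ℕ → ℂ) (hf : ∀ p, f p ≠ 0) (j : ℕ) :
    ∏ p ∈ Finset.range j, f (p + 1) / f p = f j / f 0 := by
  induction j with
  | zero => simp [hf]
  | succ j ih => rw [Finset.prod_range_succ, ih, mul_comm, div_mul_div_cancel₀ (hf j)]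

section Twist

variable {α : Type*} [Fintype α] {σ h : Equiv.Perm α}

open scoped Classical in
/-- The contribution of a joint orbit to the cycle character. -/
theorem prod_labelShift_orbit (hc : Commute σ h) {x : α} (hx : orbitRep σ h x = x) {b t : ℕ}
    (hw : IsTwist σ h x b t) :
    ∏ q : Quotient (Equiv.Perm.SameCycle.setoid h) with orbitRep σ h q.out = x,
      labelShift h σ q.out = dualRoot (Function.minimalPeriod σ x) t := by
  set a := Function.minimalPeriod σ x with ha
  set j := a.gcd t with hj
  have hjpos : 0 < j := Nat.gcd_pos_of_pos_left _ (minimalPeriod_perm_pos σ x)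
  have hout : ∀ y, h.SameCycle (Quotient.mk (Equiv.Perm.SameCycle.setoid h) y).out y := fun y =>
    Quotient.exact (s := Equiv.Perm.SameCycle.setoid h) (Quotient.out_eq (Quotient.mk _ y))
  have hJ : ∀ {y z}, h.SameCycle y z → JointOrbit σ h y z := by
    intro y z hyz
    obtain ⟨q, rfl⟩ := hyz.exists_nat_pow_eq
    exact .pow_apply y q
  -- The `h`-cycles in the orbit of `x` are those of `σ ^ p x` for `p < j`, without repetition.
  have hbij : ∏ p ∈ Finset.range j, labelShift h σ ((σ ^ p) x) =
      ∏ q : Quotient (Equiv.Perm.SameCycle.setoid h) with orbitRep σ h q.out = x,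
        labelShift h σ q.out := by
    refine Finset.prod_bij (fun p _ => Quotient.mk _ ((σ ^ p) x)) ?_ ?_ ?_ ?_
    · intro p _
      rw [Finset.mem_filter]
      refine ⟨Finset.mem_univ _, ?_⟩
      rw [orbitRep_eq hc (hJ (hout _)), ← orbitRep_eq hc (JointOrbit.of_sameCycle
        (Equiv.Perm.sameCycle_pow_right.2 (.refl σ x) : σ.SameCycle x ((σ ^ p) x))), hx]
    · have key : ∀ p p', p ≤ p' → p' < j → h.SameCycle ((σ ^ p) x) ((σ ^ p') x) → p = p' := by
        intro p p' hpp hp' hs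
        rw [← Nat.sub_add_cancel hpp, add_comm, pow_add, Equiv.Perm.mul_apply,
          sameCycle_apply_iff (hc.pow_left p), hw.sameCycle_iff hc] at hs
        have := Nat.eq_zero_of_dvd_of_lt hs ((Nat.sub_le p' p).trans_lt hp')
        omega
      intro p hp p' hp' heq
      have hs : h.SameCycle ((σ ^ p) x) ((σ ^ p') x) :=
        Quotient.exact (s := Equiv.Perm.SameCycle.setoid h) heq
      rw [Finset.mem_range] at hp hp'
      rcases le_total p p' with hle | hle
      · exact key p p' hle hp' hs
      · exact (key p' p hle hp hs.symm).symm
    · intro q hq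
      have hq' : orbitRep σ h q.out = x := (Finset.mem_filter.1 hq).2
      have h1 : JointOrbit σ h x q.out := by
        have := jointOrbit_orbitRep σ h q.out
        rw [hq'] at this
        exact this.symm hc
      obtain ⟨n, hn⟩ := h1
      obtain ⟨p, hp⟩ := hn.exists_nat_pow_eq
      refine ⟨p % j, Finset.mem_range.2 (Nat.mod_lt _ hjpos), ?_⟩
      rw [← Quotient.out_eq q]
      refine Quotient.sound (s := Equiv.Perm.SameCycle.setoid h)
        (show h.SameCycle ((σ ^ (p % j)) x) q.out from ?_)
      rw [← hp, ← Equiv.Perm.mul_apply, (hc.pow_pow p n).eq, Equiv.Perm.mul_apply]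
      refine Equiv.Perm.sameCycle_pow_right.2 ?_
      conv_rhs => rw [← Nat.mod_add_div p j, pow_add, Equiv.Perm.mul_apply]
      rw [sameCycle_apply_iff (hc.pow_left _), hw.sameCycle_iff hc]
      exact dvd_mul_right _ _
    · intro p _
      exact labelShift_sameCycle hc (hout _).symm
  rw [← hbij]
  have h1 : ∀ p, labelShift h σ ((σ ^ p) x) =
      cycleLabel h ((σ ^ (p + 1)) x) / cycleLabel h ((σ ^ p) x) := by
    intro p
    rw [labelShift, pow_succ', Equiv.Perm.mul_apply]
  simp_rw [h1]
  -- The product telescopes to the ratio of the labels of `σ ^ j x` and `x`, which lie on the same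
  -- `h`-cycle.
  rw [prod_range_div_of_ne_zero (fun p => cycleLabel h ((σ ^ p) x))
    fun p => cycleLabel_ne_zero _ _]
  obtain ⟨s, hs, hs'⟩ := hw.exists_dual hc
  rw [← hs', hj, ha, hs, cycleLabel_pow_apply, pow_zero, Equiv.Perm.one_apply,
    mul_div_cancel_right₀ _ (cycleLabel_ne_zero _ _)]
  rfl

open scoped Classical in
theorem cycleCharacter_eq_prod (hc : Commute σ h) {b t : α → ℕ}
    (hw : ∀ x, IsTwist σ h x (b x) (t x)) :
    cycleCharacter h σ = ∏ x, if orbitRep σ h x = x then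
      dualRoot (Function.minimalPeriod σ x) (t x) else 1 := by
  rw [cycleCharacter, ← Finset.prod_fiberwise (g := fun q => orbitRep σ h q.out)]
  refine Finset.prod_congr rfl fun x _ => ?_
  split_ifs with hx
  · exact prod_labelShift_orbit hc hx (hw x)
  -- The fibre over a point that is not a representative is empty.
  · refine Finset.prod_eq_one fun q hq => ?_
    have hq' : orbitRep σ h q.out = x := (Finset.mem_filter.1 hq).2
    refine absurd ?_ hx
    rw [← hq', ← orbitRep_eq hc (jointOrbit_orbitRep σ h q.out)]

end Twist

/-! ### Averaging over rotations of cycles -/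

section OrbitTwist

variable {α : Type*}

open scoped Classical in
/-- Rotate the `σ`-cycle of each point `x` of the form `ρ y` by `σ ^ i x`. -/
noncomputable def rotateCycles (σ : Equiv.Perm α) (ρ : α → α) (i : α → ℕ) (y : α) : α :=
  if σ.SameCycle (ρ y) y then (σ ^ i (ρ y)) y else y

theorem sameCycle_rotateCycles (σ : Equiv.Perm α) (ρ : α → α) (i : α → ℕ) (y : α) :
    σ.SameCycle y (rotateCycles σ ρ i y) := by
  rw [rotateCycles]
  split_ifs
  · exact Equiv.Perm.sameCycle_pow_right.2 (.refl _ _)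
  · exact .refl _ _

theorem rotateCycles_apply_comm {σ : Equiv.Perm α} {ρ : α → α}
    (hρ : ∀ x y, σ.SameCycle x y → ρ x = ρ y) (i : α → ℕ) (y : α) :
    rotateCycles σ ρ i (σ y) = σ (rotateCycles σ ρ i y) := by
  have h1 : ρ (σ y) = ρ y := (hρ _ _ (Equiv.Perm.sameCycle_apply_right.2 (.refl _ _))).symm
  have h2 : σ.SameCycle (ρ y) (σ y) ↔ σ.SameCycle (ρ y) y := Equiv.Perm.sameCycle_apply_right
  by_cases hy : σ.SameCycle (ρ y) y
  · rw [rotateCycles, rotateCycles, h1, if_pos (h2.2 hy), if_pos hy,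
      ← Equiv.Perm.mul_apply, ← pow_succ, pow_succ', Equiv.Perm.mul_apply]
  · rw [rotateCycles, rotateCycles, h1, if_neg (mt h2.1 hy), if_neg hy]

theorem rotateCycles_injective {σ : Equiv.Perm α} {ρ : α → α}
    (hρ : ∀ x y, σ.SameCycle x y → ρ x = ρ y) (i : α → ℕ) :
    Function.Injective (rotateCycles σ ρ i) := by
  intro x y hxy
  have hs : σ.SameCycle x y := by
    have := sameCycle_rotateCycles σ ρ i x
    rw [hxy] at this
    exact this.trans (sameCycle_rotateCycles σ ρ i y).symm
  have h1 := hρ x y hs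
  have h2 : σ.SameCycle (ρ y) x ↔ σ.SameCycle (ρ y) y := ⟨fun h => h.trans hs,
    fun h => h.trans hs.symm⟩
  by_cases hy : σ.SameCycle (ρ y) y
  · rw [rotateCycles, rotateCycles, h1, if_pos (h2.2 hy), if_pos hy] at hxy
    exact (σ ^ i (ρ y)).injective hxy
  · rwa [rotateCycles, rotateCycles, h1, if_neg (mt h2.1 hy), if_neg hy] at hxy

variable [Finite α] {σ : Equiv.Perm α}

theorem orbitRep_sameCycle (h : {h : Equiv.Perm α // Commute σ h}) (x y : α)
    (hxy : σ.SameCycle x y) : orbitRep σ h.1 x = orbitRep σ h.1 y :=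
  orbitRep_eq h.2 (.of_sameCycle hxy)

/-- Compose `h` with rotations of the `σ`-cycles of the representatives of the joint orbits. -/
noncomputable def orbitTwist (i : α → ℕ) (h : {h : Equiv.Perm α // Commute σ h}) :
    {h : Equiv.Perm α // Commute σ h} :=
  ⟨h.1 * Equiv.ofBijective (rotateCycles σ (orbitRep σ h.1) i)
      (Finite.injective_iff_bijective.1 (rotateCycles_injective (orbitRep_sameCycle h) i)), by
    refine h.2.mul_right (Equiv.ext fun y => ?_)
    exact (rotateCycles_apply_comm (orbitRep_sameCycle h) i y).symm⟩

theorem orbitTwist_apply (i : α → ℕ) (h : {h : Equiv.Perm α // Commute σ h}) (x : α) :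
    (orbitTwist i h).1 x = h.1 (rotateCycles σ (orbitRep σ h.1) i x) := rfl

theorem sameCycle_orbitTwist (i : α → ℕ) (h : {h : Equiv.Perm α // Commute σ h}) (x : α) :
    σ.SameCycle (h.1 x) ((orbitTwist i h).1 x) :=
  sameCycle_map h.2 (sameCycle_rotateCycles _ _ _ _)

theorem orbitRep_orbitTwist (i : α → ℕ) (h : {h : Equiv.Perm α // Commute σ h}) :
    orbitRep σ (orbitTwist i h).1 = orbitRep σ h.1 :=
  (orbitRep_congr h.2 (sameCycle_orbitTwist i h)).symm

/-- The twist preserves the representatives, so the rotation it applied can be read off from the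
result and undone. -/
theorem orbitTwist_bijective (i : α → ℕ) :
    Function.Bijective (orbitTwist (σ := σ) i) := by
  refine Finite.injective_iff_bijective.1 fun h h' heq => ?_
  have h1 : orbitRep σ h.1 = orbitRep σ h'.1 := by
    rw [← orbitRep_orbitTwist i h, heq, orbitRep_orbitTwist]
  have hsurj : Function.Surjective (rotateCycles σ (orbitRep σ h.1) i) :=
    (Finite.injective_iff_bijective.1 (rotateCycles_injective (orbitRep_sameCycle h) i)).2
  refine Subtype.ext (Equiv.ext fun y => ?_)
  obtain ⟨x, rfl⟩ := hsurj y
  have h2 := congrArg (fun e : {h : Equiv.Perm α // Commute σ h} => e.1 x) heq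
  simp only [orbitTwist_apply] at h2
  rw [h2, h1]

/-- The rotation acts once, at the first step: the path from `x` does not meet the `σ`-cycle of `x`
again before step `b`. At `q = 0` no rotation has been applied yet. -/
theorem orbitTwist_pow_apply (i : α → ℕ) (h : {h : Equiv.Perm α // Commute σ h}) {x : α}
    (hx : orbitRep σ h.1 x = x) {b t : ℕ} (hw : IsTwist σ h.1 x b t) (q : ℕ) (hq : 0 < q)
    (hqb : q ≤ b) : ((orbitTwist i h).1 ^ q) x = (σ ^ i x) ((h.1 ^ q) x) := by
  have hcomm : ∀ y, h.1 ((σ ^ i x) y) = (σ ^ i x) (h.1 y) := fun y =>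
    congrArg (fun e : Equiv.Perm α => e y) (h.2.pow_left (i x)).symm.eq
  induction q, hq using Nat.le_induction with
  | base =>
    rw [pow_one, pow_one, orbitTwist_apply, rotateCycles, hx, if_pos (.refl _ _), hcomm]
  | succ q hq ih =>
    have hnot : ¬ σ.SameCycle x ((σ ^ i x) ((h.1 ^ q) x)) := by
      rw [Equiv.Perm.sameCycle_pow_right]
      exact hw.not_sameCycle q hq (by omega)
    have hrep : orbitRep σ h.1 ((σ ^ i x) ((h.1 ^ q) x)) = x := by
      rw [← orbitRep_eq h.2 (x := x) ⟨q, Equiv.Perm.sameCycle_pow_right.2 (.refl _ _)⟩, hx]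
    rw [pow_succ', Equiv.Perm.mul_apply, ih (by omega), orbitTwist_apply, rotateCycles, hrep,
      if_neg hnot, hcomm, pow_succ', Equiv.Perm.mul_apply]

theorem isTwist_orbitTwist (i : α → ℕ) (h : {h : Equiv.Perm α // Commute σ h}) {x : α}
    (hx : orbitRep σ h.1 x = x) {b t : ℕ} (hw : IsTwist σ h.1 x b t) :
    IsTwist σ (orbitTwist i h).1 x b (t + i x) where
  pos := hw.pos
  pow_apply := by
    rw [orbitTwist_pow_apply i h hx hw b hw.pos le_rfl, hw.pow_apply, ← Equiv.Perm.mul_apply,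
      ← pow_add, add_comm]
  not_sameCycle q hq hqb := by
    rw [orbitTwist_pow_apply i h hx hw q hq hqb.le, Equiv.Perm.sameCycle_pow_right]
    exact hw.not_sameCycle q hq hqb

end OrbitTwist

section RootSum

variable {α : Type*} [Fintype α] {σ : Equiv.Perm α}

open scoped Classical in
theorem prod_ite_orbitRep (ρ : α → α) (P : α → Prop) [DecidablePred P] (f : α → ℂ) :
    (∏ x, if ρ x = x then (if P x then f x else 0) else 1) =
      if ∀ x, ρ x = x → P x then ∏ x, (if ρ x = x then f x else 1) else 0 := by
  split_ifs with H
  · refine Finset.prod_congr rfl fun x _ => ?_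
    by_cases hx : ρ x = x
    · simp [hx, H x hx]
    · simp [hx]
  · push Not at H
    obtain ⟨x, hx, hP⟩ := H
    refine Finset.prod_eq_zero (Finset.mem_univ x) ?_
    simp [hx, hP]

/-- The twists only matter at the representatives of the joint orbits. -/
theorem exists_isTwist_extend {h : Equiv.Perm α} {b t : α → ℕ}
    (hw : ∀ x, orbitRep σ h x = x → IsTwist σ h x (b x) (t x)) :
    ∃ b' t' : α → ℕ, (∀ x, IsTwist σ h x (b' x) (t' x)) ∧
      ∀ x, orbitRep σ h x = x → b' x = b x ∧ t' x = t x := by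
  classical
  choose b₀ t₀ h₀ using exists_isTwist σ h
  refine ⟨fun x => if orbitRep σ h x = x then b x else b₀ x,
    fun x => if orbitRep σ h x = x then t x else t₀ x, fun x => ?_, fun x hx => by simp [hx]⟩
  by_cases hx : orbitRep σ h x = x
  · simpa [hx] using hw x hx
  · simpa [hx] using h₀ x

open scoped Classical in
theorem ite_pow_eq_one_cycleCharacter (k : ℕ) {h : Equiv.Perm α} (hc : Commute σ h)
    {b t : α → ℕ} (hw : ∀ x, orbitRep σ h x = x → IsTwist σ h x (b x) (t x)) :
    (if h ^ k = 1 then cycleCharacter h σ else 0) =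
      ∏ x, if orbitRep σ h x = x then
        (if b x ∣ k ∧ Function.minimalPeriod σ x ∣ t x * (k / b x) then
          dualRoot (Function.minimalPeriod σ x) (t x) else 0) else 1 := by
  rw [prod_ite_orbitRep]
  refine if_congr ?_ ?_ rfl
  · rw [perm_eq_iff_orbitRep hc (hc.pow_right k) (Commute.one_right σ)
      ((Commute.refl h).pow_right k) (Commute.one_right h)]
    refine forall₂_congr fun x hx => ?_
    exact (hw x hx).pow_apply_eq_self_iff hc k
  · obtain ⟨b', t', hw', hbt⟩ := exists_isTwist_extend hw
    rw [cycleCharacter_eq_prod hc hw']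
    refine Finset.prod_congr rfl fun x _ => ?_
    by_cases hx : orbitRep σ h x = x
    · simp [hx, (hbt x hx).2]
    · simp [hx]

open scoped Classical in
theorem ite_pow_eq (k : ℕ) {h : Equiv.Perm α} (hc : Commute σ h)
    {b t : α → ℕ} (hw : ∀ x, orbitRep σ h x = x → IsTwist σ h x (b x) (t x)) :
    (if h ^ k = σ then (1 : ℂ) else 0) =
      ∏ x, if orbitRep σ h x = x then
        (if b x ∣ k ∧ t x * (k / b x) ≡ 1 [MOD Function.minimalPeriod σ x] then
          1 else 0) else 1 := by
  rw [prod_ite_orbitRep]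
  refine if_congr ?_ (by simp) rfl
  rw [perm_eq_iff_orbitRep hc (hc.pow_right k) (Commute.refl σ)
    ((Commute.refl h).pow_right k) hc.symm]
  refine forall₂_congr fun x hx => ?_
  exact (hw x hx).pow_apply_eq_iff hc 1 k

-- As `i` varies, the twists at different representatives run independently over full residue
-- systems. Both sums thus become products of local sums, matched by `sum_local_weights`;
-- coordinates of `i` at other points contribute equal constants.
open scoped Classical in
theorem sum_orbitTwist (k : ℕ) (h : {h : Equiv.Perm α // Commute σ h}) :
    (∑ i ∈ Fintype.piFinset fun x => Finset.range (Function.minimalPeriod σ x),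
      if (orbitTwist i h).1 ^ k = 1 then cycleCharacter (orbitTwist i h).1 σ else 0) =
    ∑ i ∈ Fintype.piFinset fun x => Finset.range (Function.minimalPeriod σ x),
      if (orbitTwist i h).1 ^ k = σ then (1 : ℂ) else 0 := by
  choose b t hw using exists_isTwist σ h.1
  have hw' : ∀ (i : α → ℕ) x, orbitRep σ (orbitTwist i h).1 x = x →
      IsTwist σ (orbitTwist i h).1 x (b x) (t x + i x) := fun i x hx =>
    isTwist_orbitTwist i h (by rwa [orbitRep_orbitTwist] at hx) (hw x)
  rw [Finset.sum_congr rfl fun i _ =>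
      ite_pow_eq_one_cycleCharacter k (orbitTwist i h).2 (hw' i),
    Finset.sum_congr rfl fun i _ => ite_pow_eq k (orbitTwist i h).2 (hw' i)]
  simp only [orbitRep_orbitTwist]
  rw [← Finset.prod_univ_sum (fun x => Finset.range (Function.minimalPeriod σ x)) fun x n =>
      if orbitRep σ h.1 x = x then
        (if b x ∣ k ∧ Function.minimalPeriod σ x ∣ (t x + n) * (k / b x) then
          dualRoot (Function.minimalPeriod σ x) (t x + n) else 0) else 1,
    ← Finset.prod_univ_sum (fun x => Finset.range (Function.minimalPeriod σ x)) fun x n =>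
      if orbitRep σ h.1 x = x then
        (if b x ∣ k ∧ (t x + n) * (k / b x) ≡ 1 [MOD Function.minimalPeriod σ x] then
          (1 : ℂ) else 0) else 1]
  refine Finset.prod_congr rfl fun x _ => ?_
  by_cases hx : orbitRep σ h.1 x = x
  · simp only [hx, if_true]
    exact sum_local_weights (minimalPeriod_perm_pos σ x) _ _ _
  · simp only [hx, if_false]

open scoped Classical in
/-- The `k`-th roots of `σ` are counted by the values at `σ` of the characters attached to the
`k`-th roots of the identity commuting with `σ`. A condition `Φ h` depending only on the action
of `h` on the cycles of `σ` may be imposed on both sides. -/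
theorem sum_cycleCharacter_eq_card (σ : Equiv.Perm α) (k : ℕ) (Φ : Equiv.Perm α → Prop)
    (hΦ : ∀ h h', Commute σ h → Commute σ h' → (∀ x, σ.SameCycle (h x) (h' x)) →
      (Φ h ↔ Φ h')) :
    (∑ h : Equiv.Perm α, if Commute σ h ∧ h ^ k = 1 ∧ Φ h then cycleCharacter h σ else 0) =
      ∑ h : Equiv.Perm α, if h ^ k = σ ∧ Φ h then (1 : ℂ) else 0 := by
  let I := Fintype.piFinset fun x : α => Finset.range (Function.minimalPeriod σ x)
  have hI : (I.card : ℂ) ≠ 0 := by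
    rw [Nat.cast_ne_zero, Finset.card_ne_zero]
    refine ⟨fun _ => 0, ?_⟩
    simp [I, minimalPeriod_perm_pos σ]
  -- Each twist permutes the centralizer of `σ`, so averaging over all `i ∈ I` leaves sums over it
  -- unchanged.
  have havg : ∀ F : {h : Equiv.Perm α // Commute σ h} → ℂ,
      (I.card : ℂ) * ∑ h, F h = ∑ h, ∑ i ∈ I, F (orbitTwist i h) := by
    intro F
    rw [Finset.sum_comm, Finset.sum_congr rfl fun i _ =>
      Function.Bijective.sum_comp (orbitTwist_bijective (σ := σ) i) F, Finset.sum_const,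
      nsmul_eq_mul]
  have hsub : ∀ F : Equiv.Perm α → ℂ,
      (∑ h : {h : Equiv.Perm α // Commute σ h}, F h.1) =
        ∑ h : Equiv.Perm α, if Commute σ h then F h else 0 := by
    intro F
    rw [← Finset.sum_filter]
    exact (Finset.sum_subtype _ (fun h => by simp) F).symm
  have hleft := hsub fun h => if h ^ k = 1 ∧ Φ h then cycleCharacter h σ else 0
  have hright := hsub fun h => if h ^ k = σ ∧ Φ h then (1 : ℂ) else 0
  have hcomm : ∀ h : Equiv.Perm α, h ^ k = σ → Commute σ h := by
    rintro h rfl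
    exact (Commute.refl h).pow_left k
  have hL : (∑ h : Equiv.Perm α, if Commute σ h ∧ h ^ k = 1 ∧ Φ h then cycleCharacter h σ else 0)
      = ∑ h : Equiv.Perm α, if Commute σ h then
        (if h ^ k = 1 ∧ Φ h then cycleCharacter h σ else 0) else 0 :=
    Finset.sum_congr rfl fun h _ => ite_and ..
  have hR : (∑ h : Equiv.Perm α, if h ^ k = σ ∧ Φ h then (1 : ℂ) else 0)
      = ∑ h : Equiv.Perm α, if Commute σ h then
        (if h ^ k = σ ∧ Φ h then (1 : ℂ) else 0) else 0 := by
    refine Finset.sum_congr rfl fun h _ => ?_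
    by_cases hh : h ^ k = σ
    · simp [hh, hcomm h hh]
    · simp [hh]
  rw [hL, hR, ← hleft, ← hright]
  refine mul_left_cancel₀ hI ?_
  rw [havg fun h => if h.1 ^ k = 1 ∧ Φ h.1 then cycleCharacter h.1 σ else 0,
    havg fun h => if h.1 ^ k = σ ∧ Φ h.1 then (1 : ℂ) else 0]
  refine Finset.sum_congr rfl fun h _ => ?_
  have hΦ' : ∀ i, Φ (orbitTwist i h).1 ↔ Φ h.1 := fun i =>
    (hΦ _ _ h.2 (orbitTwist i h).2 (sameCycle_orbitTwist i h)).symm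
  by_cases hh : Φ h.1
  · simp only [hΦ', hh, and_true]
    exact sum_orbitTwist k h
  · simp only [hΦ', hh, and_false, if_false]

end RootSum

/-! ### Fourier inversion over sign vectors -/

section SignFourier

variable {α : Type*}

/-- The inclusion of `ℤˣ = {1, -1}` into `ℂ`. -/
def unitsIntToComplex : ℤˣ →* ℂ := (Int.castRingHom ℂ : ℤ →* ℂ).comp (Units.coeHom ℤ)

theorem ite_unitsInt_eq (u v : ℤˣ) : (if u = v then (1 : ℂ) else 0) =
    2⁻¹ * (1 + unitsIntToComplex u * unitsIntToComplex v) := by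
  rcases Int.units_eq_one_or u with rfl | rfl <;> rcases Int.units_eq_one_or v with rfl | rfl <;>
    norm_num [unitsIntToComplex]

theorem sum_unitsInt_pow (m : ℕ) :
    ∑ u : ℤˣ, unitsIntToComplex u ^ m = if Even m then 2 else 0 := by
  have h : (Finset.univ : Finset ℤˣ) = {1, -1} := rfl
  rw [h, Finset.sum_pair (by decide)]
  split_ifs with hm
  · norm_num [unitsIntToComplex, hm.neg_one_pow]
  · norm_num [unitsIntToComplex, (Nat.not_even_iff_odd.1 hm).neg_one_pow]

/-- The number of `j < k` such that `η ^ (-j)` maps `i` into `T`. -/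
def visits [DecidableEq α] (k : ℕ) (η : Equiv.Perm α) (T : Finset α) (i : α) : ℕ :=
  ∑ j ∈ Finset.range k, if (η⁻¹ ^ j) i ∈ T then 1 else 0

theorem prod_mem_prod_pow [Fintype α] [DecidableEq α] (k : ℕ) (η : Equiv.Perm α)
    (T : Finset α) (f : α → ℂ) :
    ∏ i ∈ T, ∏ j ∈ Finset.range k, f ((η ^ j) i) = ∏ i, f i ^ visits k η T i := by
  rw [Finset.prod_comm]
  simp only [visits, ← Finset.prod_pow_eq_pow_sum]
  conv_rhs => rw [Finset.prod_comm]
  refine Finset.prod_congr rfl fun j _ => ?_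
  rw [← Finset.prod_subset (Finset.subset_univ (T.image (η ^ j)))]
  · rw [Finset.prod_image fun x _ y _ h => (η ^ j).injective h]
    refine Finset.prod_congr rfl fun i hi => ?_
    rw [inv_pow, Equiv.Perm.coe_inv, Equiv.symm_apply_apply, if_pos hi, pow_one]
  · intro i _ hi
    rw [if_neg, pow_zero]
    intro h
    refine hi (Finset.mem_image.2 ⟨_, h, ?_⟩)
    rw [inv_pow, Equiv.Perm.coe_inv, Equiv.apply_symm_apply]

/-- The number of sign vectors with product `1` and prescribed products along the first `k` steps of
the orbits of `η`, by Fourier inversion. -/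
theorem sum_signs_eq [Fintype α] [DecidableEq α] (k : ℕ) (η : Equiv.Perm α) (v : α → ℤˣ) :
    (∑ τ : α → ℤˣ, if (∏ i, τ i = 1) ∧ ∀ i, ∏ j ∈ Finset.range k, τ ((η ^ j) i) = v i
      then (1 : ℂ) else 0) =
    2⁻¹ * ∑ c : Fin 2, ∑ T : Finset α, if ∀ i, Even ((c : ℕ) + visits k η T i) then
      unitsIntToComplex (∏ i ∈ T, v i) else 0 := by
  set κ := unitsIntToComplex with hκ
  -- Each indicator is expanded as `(1 + u * v) / 2`. Choosing the second term is recorded by `c =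
  -- 1` for the total product, and by `i ∈ T` for the condition at `i`.
  have h1 : ∀ τ : α → ℤˣ,
      (if (∏ i, τ i = 1) ∧ ∀ i, ∏ j ∈ Finset.range k, τ ((η ^ j) i) = v i
        then (1 : ℂ) else 0) =
      2⁻¹ * ∑ c : Fin 2, ∑ T : Finset α, (2⁻¹ : ℂ) ^ Fintype.card α * (κ (∏ i ∈ T, v i) *
        ∏ i, κ (τ i) ^ ((c : ℕ) + visits k η T i)) := by
    intro τ
    have h2 : (if (∏ i, τ i = 1) ∧ ∀ i, ∏ j ∈ Finset.range k, τ ((η ^ j) i) = v i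
        then (1 : ℂ) else 0) = (if ∏ i, τ i = 1 then 1 else 0) *
          ∏ i, if ∏ j ∈ Finset.range k, τ ((η ^ j) i) = v i then 1 else 0 := by
      rw [Finset.prod_ite_zero]
      simp only [Finset.mem_univ, true_imp_iff, Finset.prod_const_one, ite_and, ite_mul, one_mul,
        zero_mul]
    have h3 : (∏ i, if ∏ j ∈ Finset.range k, τ ((η ^ j) i) = v i then (1 : ℂ) else 0) =
        ∑ T : Finset α, (2⁻¹ : ℂ) ^ Fintype.card α * (κ (∏ i ∈ T, v i) *
          ∏ i, κ (τ i) ^ visits k η T i) := by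
      simp_rw [ite_unitsInt_eq]
      rw [Finset.prod_mul_distrib, Finset.prod_const, Finset.card_univ, Finset.prod_one_add,
        Finset.powerset_univ, Finset.mul_sum]
      refine Finset.sum_congr rfl fun T _ => ?_
      rw [Finset.prod_mul_distrib, mul_comm (∏ i ∈ T, _), ← map_prod]
      simp_rw [map_prod]
      rw [prod_mem_prod_pow k η T fun i => κ (τ i)]
    rw [h2, h3, ite_unitsInt_eq, map_one, mul_one, mul_assoc, Fin.sum_univ_two, add_mul, one_mul,
      Finset.mul_sum]
    congr 2
    · simp
    · refine Finset.sum_congr rfl fun T _ => ?_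
      simp only [Fin.val_one, pow_add, pow_one, Finset.prod_mul_distrib, map_prod]
      ring
  simp_rw [h1]
  rw [← Finset.mul_sum, Finset.sum_comm]
  congr 1
  refine Finset.sum_congr rfl fun c _ => ?_
  rw [Finset.sum_comm]
  refine Finset.sum_congr rfl fun T _ => ?_
  rw [← Finset.mul_sum, ← Finset.mul_sum]
  have h4 : ∑ τ : α → ℤˣ, ∏ i, κ (τ i) ^ ((c : ℕ) + visits k η T i) =
      ∏ i : α, ∑ u : ℤˣ, κ u ^ ((c : ℕ) + visits k η T i) := by
    rw [Finset.prod_univ_sum, Fintype.piFinset_univ]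
  rw [h4]
  simp_rw [hκ, sum_unitsInt_pow]
  rw [Finset.prod_ite_zero]
  simp only [Finset.mem_univ, true_imp_iff, Finset.prod_const, Finset.card_univ]
  -- Each point contributes `2` when its exponent is even, cancelling the factor `2⁻¹` per point.
  split_ifs
  · rw [mul_comm, mul_assoc, ← mul_pow]
    norm_num
  · simp

theorem mem_iff_of_sameCycle [Finite α] {σ : Equiv.Perm α} {T : Finset α}
    (hT : ∀ i, σ i ∈ T ↔ i ∈ T)
    {x y : α} (hxy : σ.SameCycle x y) : x ∈ T ↔ y ∈ T := by
  obtain ⟨p, rfl⟩ := hxy.exists_nat_pow_eq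
  induction p with
  | zero => rfl
  | succ p ih =>
    rw [pow_succ', Equiv.Perm.mul_apply, hT]
    exact ih (Equiv.Perm.sameCycle_pow_right.2 (.refl _ _))

/-- For a `σ`-stable `T`, membership in `T` sees only the `σ`-cycle of a point. This makes the
parity condition admissible in `sum_cycleCharacter_eq_card`. -/
theorem visits_congr [Finite α] [DecidableEq α] {σ h h' : Equiv.Perm α} {T : Finset α}
    (hT : ∀ i, σ i ∈ T ↔ i ∈ T)
    (hc : Commute σ h) (hc' : Commute σ h') (hh : ∀ x, σ.SameCycle (h x) (h' x)) (k : ℕ) :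
    visits k h T = visits k h' T := by
  have hinv : ∀ x, σ.SameCycle (h⁻¹ x) (h'⁻¹ x) := by
    intro x
    have := hh (h⁻¹ x)
    rw [Equiv.Perm.coe_inv, Equiv.apply_symm_apply] at this
    rw [← sameCycle_apply_iff hc'.symm, Equiv.Perm.coe_inv, Equiv.Perm.coe_inv,
      Equiv.apply_symm_apply]
    exact this.symm
  funext i
  refine Finset.sum_congr rfl fun j _ => ?_
  simp only [mem_iff_of_sameCycle hT (sameCycle_pow_of_sameCycle hc.inv_right hinv j i)]

/-- The visit counts at `η ^ k i` and at its predecessor under `η` share all terms except one each,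
for `η ^ k i` and for `i`. Equal parity makes these two agree. -/
theorem mem_iff_of_even_visits [DecidableEq α] {k c : ℕ} {η : Equiv.Perm α} {T : Finset α}
    (hN : ∀ i, Even (c + visits k η T i)) (i : α) : (η ^ k) i ∈ T ↔ i ∈ T := by
  have h1 := Finset.sum_range_succ
    (fun j => if (η⁻¹ ^ j) ((η ^ k) i) ∈ T then 1 else 0) k
  have h2 := Finset.sum_range_succ'
    (fun j => if (η⁻¹ ^ j) ((η ^ k) i) ∈ T then 1 else 0) k
  have h3 : (η⁻¹ ^ k) ((η ^ k) i) = i := by rw [inv_pow, Equiv.Perm.coe_inv, Equiv.symm_apply_apply]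
  have h4 : ∀ j, (η⁻¹ ^ (j + 1)) ((η ^ k) i) = (η⁻¹ ^ j) (η⁻¹ ((η ^ k) i)) := fun j => by
    rw [pow_succ, Equiv.Perm.mul_apply]
  rw [h1] at h2
  simp only [h3, h4, pow_zero, Equiv.Perm.one_apply] at h2
  have h5 := hN ((η ^ k) i)
  have h6 := hN (η⁻¹ ((η ^ k) i))
  simp only [visits] at h5 h6
  by_cases ha : (η ^ k) i ∈ T <;> by_cases hb : i ∈ T <;> simp only [ha, hb, if_true, if_false] at h2 ⊢
  · rw [add_zero] at h2
    rw [h2, ← add_assoc] at h5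
    exact absurd h6 (Nat.even_add_one.1 h5)
  · rw [add_zero] at h2
    rw [← h2, ← add_assoc] at h6
    exact absurd h5 (Nat.even_add_one.1 h6)

/-- The stabilizer of `T` in the centralizer of `η`. -/
def stabilizerCentralizer (η : Equiv.Perm α) (T : Finset α) : Subgroup (Equiv.Perm α) where
  carrier := {σ | Commute σ η ∧ ∀ i, σ i ∈ T ↔ i ∈ T}
  one_mem' := ⟨Commute.one_left η, fun _ => Iff.rfl⟩
  mul_mem' := fun ha hb => ⟨ha.1.mul_left hb.1, fun i => (ha.2 _).trans (hb.2 i)⟩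
  inv_mem' := fun {σ} ha => ⟨ha.1.inv_left, fun i => by
    rw [← ha.2 (σ⁻¹ i), Equiv.Perm.coe_inv, Equiv.apply_symm_apply]⟩

theorem mem_stabilizerCentralizer {η σ : Equiv.Perm α} {T : Finset α} :
    σ ∈ stabilizerCentralizer η T ↔ Commute σ η ∧ ∀ i, σ i ∈ T ↔ i ∈ T := Iff.rfl

-- If `σ` does not preserve `T`, the left side vanishes by `mem_iff_of_even_visits` and the right
-- side by the stabilizer condition. Otherwise this is the root count with the parity condition as
-- `Φ`.
open scoped Classical in
theorem sum_roots_visits [Fintype α] [DecidableEq α] (k c : ℕ) (σ : Equiv.Perm α) (T : Finset α) :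
    (∑ η : Equiv.Perm α, if η ^ k = σ ∧ ∀ i, Even (c + visits k η T i) then (1 : ℂ) else 0) =
      ∑ η : Equiv.Perm α, if η ^ k = 1 ∧ ∀ i, Even (c + visits k η T i) then
        (if σ ∈ stabilizerCentralizer η T then cycleCharacter η σ else 0) else 0 := by
  by_cases hT : ∀ i, σ i ∈ T ↔ i ∈ T
  · have key := sum_cycleCharacter_eq_card σ k (fun η => ∀ i, Even (c + visits k η T i))
      fun h h' hc hc' hh => by rw [visits_congr hT hc hc' hh k]
    obtain rfl : ‹DecidableEq α› = fun a b => Classical.propDecidable (a = b) :=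
      Subsingleton.elim _ _
    refine Eq.trans ?_ (key.symm.trans ?_)
    · refine Finset.sum_congr rfl fun η _ => ?_
      congr
    · refine Finset.sum_congr rfl fun η _ => ?_
      simp only [mem_stabilizerCentralizer, hT, implies_true, and_true]
      by_cases h1 : Commute σ η <;> simp [h1]
  · rw [Finset.sum_eq_zero, Finset.sum_eq_zero]
    · intro η _
      simp [mem_stabilizerCentralizer, hT]
    · intro η _
      rw [if_neg]
      rintro ⟨rfl, hN⟩
      exact hT (mem_iff_of_even_visits hN)

end SignFourier

/-! ### Signed permutations and the monomial formula for `D_n` -/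

section SignedPerm

variable {n : ℕ}

/-- The permutation `i ↦ |w i|`. -/
noncomputable def absPerm : signedPerm n →* Equiv.Perm (Fin n) where
  toFun w := Equiv.ofBijective (fun i : Fin n => (w.1 (i, 1)).1)
    (Finite.injective_iff_bijective.mp (signedPerm_abs_injective w.2))
  map_one' := Equiv.ext fun _ => rfl
  map_mul' v w := by
    ext i
    have h : (v.1 (w.1 (i, 1))).1 = (v.1 ((w.1 (i, 1)).1, 1)).1 := by
      conv_lhs => rw [← Prod.mk.eta (p := w.1 (i, 1)), signedPerm_apply v.2]
    exact congrArg Fin.val h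

/-- The sign of `w i`. -/
def signAt (w : signedPerm n) (i : Fin n) : ℤˣ := (w.1 (i, 1)).2

theorem signedPerm_apply_eq (w : signedPerm n) (i : Fin n) (ε : ℤˣ) :
    w.1 (i, ε) = (absPerm w i, ε * signAt w i) := signedPerm_apply w.2 i ε

theorem signAt_mul (v w : signedPerm n) (i : Fin n) :
    signAt (v * w) i = signAt v (absPerm w i) * signAt w i := by
  change (v.1 (w.1 (i, 1))).2 = _
  rw [signedPerm_apply_eq w, signedPerm_apply_eq v, one_mul, mul_comm]

theorem signAt_pow (w : signedPerm n) (k : ℕ) (i : Fin n) :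
    signAt (w ^ k) i = ∏ j ∈ Finset.range k, signAt w ((absPerm w ^ j) i) := by
  induction k with
  | zero => rfl
  | succ k ih => rw [pow_succ', signAt_mul, ih, Finset.prod_range_succ, mul_comm, map_pow]

theorem signedPerm_ext {v w : signedPerm n} (h1 : absPerm v = absPerm w)
    (h2 : signAt v = signAt w) : v = w := by
  refine Subtype.ext (Equiv.ext fun x => ?_)
  obtain ⟨i, ε⟩ := x
  rw [signedPerm_apply_eq, signedPerm_apply_eq, h1, h2]

/-- A signed permutation is a permutation with a vector of signs. -/
noncomputable def signedPermEquiv : signedPerm n ≃ Equiv.Perm (Fin n) × (Fin n → ℤˣ) :=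
  Equiv.ofBijective (fun w => (absPerm w, signAt w)) <| by
    refine ⟨fun v w h => signedPerm_ext (congrArg Prod.fst h) (congrArg Prod.snd h), ?_⟩
    rintro ⟨η, τ⟩
    refine ⟨⟨⟨fun x => (η x.1, x.2 * τ x.1), fun x => (η.symm x.1, x.2 * τ (η.symm x.1)),
      fun x => ?_, fun x => ?_⟩, fun i ε => ?_⟩, ?_⟩
    · simp [mul_assoc]
    · simp [mul_assoc]
    · simp
    · refine Prod.ext (Equiv.ext fun i => rfl) (funext fun i => ?_)
      exact one_mul _

theorem pow_eq_iff_signed (h g : signedPerm n) (k : ℕ) :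
    h ^ k = g ↔ absPerm h ^ k = absPerm g ∧
      ∀ i, ∏ j ∈ Finset.range k, signAt h ((absPerm h ^ j) i) = signAt g i := by
  constructor
  · rintro rfl
    exact ⟨(map_pow _ _ _).symm, fun i => (signAt_pow h k i).symm⟩
  · rintro ⟨h1, h2⟩
    exact signedPerm_ext (by rw [map_pow, h1]) (funext fun i => by rw [signAt_pow, h2])

theorem mem_weylD_iff_prod (w : signedPerm n) : w ∈ weylD n ↔ ∏ i, signAt w i = 1 := Iff.rfl

theorem rootEnumerator_weylD (k : ℕ) (g : weylD n) :
    (rootEnumerator (weylD n) (k : ℤ) g : ℂ) =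
      ∑ η : Equiv.Perm (Fin n), if η ^ k = absPerm g.1 then
        ∑ τ : Fin n → ℤˣ, (if (∏ i, τ i = 1) ∧
          ∀ i, ∏ j ∈ Finset.range k, τ ((η ^ j) i) = signAt g.1 i then (1 : ℂ) else 0) else 0 := by
  classical
  let P : Equiv.Perm (Fin n) × (Fin n → ℤˣ) → Prop := fun x =>
    x.1 ^ k = absPerm g.1 ∧ (∏ i, x.2 i = 1) ∧
      ∀ i, ∏ j ∈ Finset.range k, x.2 ((x.1 ^ j) i) = signAt g.1 i
  have hcard : rootEnumerator (weylD n) (k : ℤ) g = Nat.card {x // P x} := by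
    let e : {h : weylD n // h ^ (k : ℤ) = g} ≃ {w : signedPerm n // w ∈ weylD n ∧ w ^ k = g.1} :=
      { toFun := fun h => ⟨h.1.1, h.1.2, by
          have := congrArg Subtype.val h.2
          rwa [zpow_natCast] at this⟩
        invFun := fun w => ⟨⟨w.1, w.2.1⟩, Subtype.ext (by
          rw [zpow_natCast]
          exact w.2.2)⟩
        left_inv := fun _ => rfl
        right_inv := fun _ => rfl }
    refine Nat.card_congr (e.trans (signedPermEquiv.subtypeEquiv fun w => ?_))
    rw [pow_eq_iff_signed, mem_weylD_iff_prod]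
    exact and_left_comm
  rw [hcard, Nat.card_eq_fintype_card, Fintype.card_subtype, Finset.natCast_card_filter,
    Fintype.sum_prod_type]
  refine Finset.sum_congr rfl fun η _ => ?_
  by_cases hη : η ^ k = absPerm g.1
  · simp only [P, hη, true_and, if_true]
  · simp [P, hη]

/-- Stability of `T` lets the signs of `v` be reindexed by `|w|`. Hence the product of signs over
`T` is a linear character on the stabilizer of `T`. -/
theorem prod_signAt_mul {T : Finset (Fin n)} (v w : signedPerm n)
    (hw : ∀ i, absPerm w i ∈ T ↔ i ∈ T) :
    ∏ i ∈ T, signAt (v * w) i = (∏ i ∈ T, signAt v i) * ∏ i ∈ T, signAt w i := by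
  simp_rw [signAt_mul, Finset.prod_mul_distrib]
  congr 1
  exact Finset.prod_equiv (absPerm w) (fun i => (hw i).symm) fun i _ => rfl

-- Sign vectors are summed out first by `sum_signs_eq`; then, for each `(c, T)`, `sum_roots_visits`
-- trades the roots of `|g|` for roots of the identity, so that the index set no longer depends on
-- `g`.
open scoped Classical in
theorem rootEnumerator_weylD_eq_monomial (k : ℕ) (g : weylD n) :
    (rootEnumerator (weylD n) (k : ℤ) g : ℂ) =
      2⁻¹ * ∑ b : {b : Fin 2 × Finset (Fin n) × Equiv.Perm (Fin n) //
          b.2.2 ^ k = 1 ∧ ∀ i, Even ((b.1 : ℕ) + visits k b.2.2 b.2.1 i)},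
        if absPerm g.1 ∈ stabilizerCentralizer b.1.2.2 b.1.2.1 then
          unitsIntToComplex (∏ i ∈ b.1.2.1, signAt g.1 i) * cycleCharacter b.1.2.2 (absPerm g.1)
        else 0 := by
  rw [rootEnumerator_weylD]
  have h0 : ∀ η : Equiv.Perm (Fin n), (∑ τ : Fin n → ℤˣ, if (∏ i, τ i = 1) ∧
      ∀ i, ∏ j ∈ Finset.range k, τ ((η ^ j) i) = signAt g.1 i then (1 : ℂ) else 0) =
      2⁻¹ * ∑ c : Fin 2, ∑ T : Finset (Fin n), if ∀ i, Even ((c : ℕ) + visits k η T i) then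
        unitsIntToComplex (∏ i ∈ T, signAt g.1 i) else 0 := by
    intro η
    convert sum_signs_eq k η (signAt g.1)
  simp_rw [h0]
  have h1 : ∀ F : Fin 2 × Finset (Fin n) × Equiv.Perm (Fin n) → ℂ,
      ∑ b : {b : Fin 2 × Finset (Fin n) × Equiv.Perm (Fin n) //
          b.2.2 ^ k = 1 ∧ ∀ i, Even ((b.1 : ℕ) + visits k b.2.2 b.2.1 i)}, F b.1 =
        ∑ c : Fin 2, ∑ T : Finset (Fin n), ∑ η : Equiv.Perm (Fin n),
          if η ^ k = 1 ∧ ∀ i, Even ((c : ℕ) + visits k η T i) then F (c, T, η) else 0 := by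
    intro F
    rw [← Finset.sum_subtype (Finset.univ.filter fun b : Fin 2 × Finset (Fin n) ×
      Equiv.Perm (Fin n) => b.2.2 ^ k = 1 ∧ ∀ i, Even ((b.1 : ℕ) + visits k b.2.2 b.2.1 i))
      (fun b => by simp) F, Finset.sum_filter, Fintype.sum_prod_type]
    refine Finset.sum_congr rfl fun c _ => ?_
    rw [Fintype.sum_prod_type]
  rw [h1 fun b => if absPerm g.1 ∈ stabilizerCentralizer b.2.2 b.2.1 then
    unitsIntToComplex (∏ i ∈ b.2.1, signAt g.1 i) * cycleCharacter b.2.2 (absPerm g.1) else 0]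
  have h2 : ∀ (c : Fin 2) (T : Finset (Fin n)),
      (∑ η : Equiv.Perm (Fin n), if η ^ k = 1 ∧ ∀ i, Even ((c : ℕ) + visits k η T i) then
        (if absPerm g.1 ∈ stabilizerCentralizer η T then
          unitsIntToComplex (∏ i ∈ T, signAt g.1 i) * cycleCharacter η (absPerm g.1) else 0)
        else 0) =
      ∑ η : Equiv.Perm (Fin n), if η ^ k = absPerm g.1 then
        (if ∀ i, Even ((c : ℕ) + visits k η T i) then
          unitsIntToComplex (∏ i ∈ T, signAt g.1 i) else 0) else 0 := by
    intro c T
    have h3 := congrArg (fun z => unitsIntToComplex (∏ i ∈ T, signAt g.1 i) * z)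
      (sum_roots_visits k c (absPerm g.1) T)
    simp only [Finset.mul_sum, mul_ite, mul_one, mul_zero] at h3
    rw [eq_comm]
    refine Eq.trans (Finset.sum_congr rfl fun η _ => ?_)
      (h3.trans (Finset.sum_congr rfl fun η _ => ?_))
    · rw [ite_and]
    · rfl
  simp_rw [h2]
  have h4 : ∀ (η : Equiv.Perm (Fin n)) (z : ℂ),
      (if η ^ k = absPerm g.1 then 2⁻¹ * z else 0) =
        2⁻¹ * if η ^ k = absPerm g.1 then z else 0 := fun η z => by rw [mul_ite, mul_zero]
  simp_rw [h4]
  rw [← Finset.mul_sum]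
  congr 1
  have h5 : ∀ (η : Equiv.Perm (Fin n)) (F : Fin 2 → Finset (Fin n) → ℂ),
      (if η ^ k = absPerm g.1 then ∑ c, ∑ T, F c T else 0) =
        ∑ c, ∑ T, if η ^ k = absPerm g.1 then F c T else 0 := by
    intro η F
    split_ifs <;> simp
  simp_rw [h5]
  rw [Finset.sum_comm]
  exact Finset.sum_congr rfl fun c _ => Finset.sum_comm

end SignedPerm

theorem theoremt (k : ℤ) (n : ℕ) (hn : 1 ≤ n) :
    IsProperCharacter (fun g : weylD n => (rootEnumerator (weylD n) k g : ℂ)) := by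
  obtain ⟨m, hm⟩ := exists_rootEnumerator_eq_pos (weylD n) k
  rw [hm]
  refine isProperCharacter_rootEnumerator_of_monomial m
    (B := {b : Fin 2 × Finset (Fin n) × Equiv.Perm (Fin n) //
      b.2.2 ^ (m + 1) = 1 ∧ ∀ i, Even ((b.1 : ℕ) + visits (m + 1) b.2.2 b.2.1 i)})
    (fun b => (stabilizerCentralizer b.1.2.2 b.1.2.1).comap (absPerm.comp (weylD n).subtype))
    (fun b g => unitsIntToComplex (∏ i ∈ b.1.2.1, signAt g.1 i) *
      cycleCharacter b.1.2.2 (absPerm g.1)) (fun b => ?_) (fun b x hx y hy => ?_)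
    fun g => ?_
  · have h1 : ∏ i ∈ b.1.2.1, signAt (1 : signedPerm n) i = 1 := Finset.prod_eq_one fun i _ => rfl
    change unitsIntToComplex (∏ i ∈ b.1.2.1, signAt (1 : signedPerm n) i) *
      cycleCharacter b.1.2.2 (absPerm 1) = 1
    rw [h1, map_one, map_one, cycleCharacter_one, one_mul]
  · have hx' : absPerm x.1 ∈ stabilizerCentralizer b.1.2.2 b.1.2.1 := hx
    have hy' : absPerm y.1 ∈ stabilizerCentralizer b.1.2.2 b.1.2.1 := hy
    rw [Subgroup.coe_mul, prod_signAt_mul _ _ hy'.2, map_mul, map_mul,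
      cycleCharacter_mul hx'.1 hy'.1]
    ring
  · rw [rootEnumerator_weylD_eq_monomial]
    rfl
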